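/- **Partitions.** For $n\ge1$ let $\mathcal P(n)$ be the set of all set partitions of $[n]=\{1,\dots,n\}$. Let $\mathrm{CO}(n)\subseteq\mathcal P(n)$ be the set of connected partitions, i.e. those $\pi$ such that no proper subinterval $\{p+1,\dots,p+q\}$ of $[n]$ ($0\le p<p+q\le n$, $q<n$) is a union of blocks of $\pi$. Let $\mathrm{PC}^+(n)$ be the set of $\pi\in\mathrm{CO}(n)$ for which no block contains two neighbors $k,k+1$, and let $\mathrm{PC}(n)$ (the purely crossing partitions) be the set of $\pi\in\mathrm{PC}^+(n)$ for which $1$ and $n$ lie in different blocks. **The maps $\Lambda_\pi$.** For $\pi\in\mathcal P(n)$ let $\Lambda_\pi:C[0,1]^{n-1}\to C[0,1]$ be the $(n-1)$-linear map $$\Lambda_\pi(g_1,\dots,g_{n-1})(x)=\int g_1(t_1)\cdots g_{n-1}(t_{n-1}),$$ where the integral is over the polytope of all $(t_1,\dots,t_{n-1})\in[0,1]^{n-1}$ which, with $t_0=t_n=x$, satisfy $\sum_{j\in S}t_j=\sum_{j\in S}t_{j-1}$ for every block $S$ of $\pi$, with respect to Lebesgue measure in the $n-|\pi|$ free coordinates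 $t_{j-1}$ ($2\le j\le n$, $j$ not the least element of its block). (These are the maps that occur in the asymptotic moments of random Vandermonde matrices.) Let $\tau(f)=\int_0^1f(y)\,dy$ for $f\in C[0,1]$. **Formal series.** A formal multilinear series over $C[0,1]$ is a sequence $P=(P_n)_{n\ge0}$ with $P_n$ a bounded $n$-linear map $C[0,1]^n\to C[0,1]$; it is written as a formal power series $P(g)=\sum_nP_n(g,\dots,g)$ in a variable $g\in C[0,1]$. Products and compositions are $$(PQ)_n(v_1,\dots,v_n)=\sum_{k=0}^nP_k(v_1,\dots,v_k)\,Q_{n-k}(v_{k+1},\dots,v_n),$$ $$(P\circ Q)_n(v_1,\dots,v_n)=\sum_{\ell}\ \sum_{\substack{k_1,\dots,k_\ell\ge1\\k_1+\dots+k_\ell=n}}P_\ell\big(Q_{k_1}(v_1,\dots,v_{k_1}),\dots,Q_{k_\ell}(v_{n-k_\ell+1},\dots,v_n)\big).$$ The constant series $1$ is neutral for the product, the series $g$ (the identity map in degree $1$) is neutral for the composition, and $\tau(P(g))$ denotes the series with terms $\tau(P_n(v_1,\dots,v_n))\cdot1$. Let $A,B,C,D$ be the formal multilinear series whose $n$-th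 terms, for $n\ge1$, are the sums of the $n$-linear maps $(g_1,\dots,g_n)\mapsto\Lambda_\pi(g_1,\dots,g_{n-1})\,g_n$ over all $\pi$ in $\mathrm{PC}(n)$, $\mathrm{PC}^+(n)$, $\mathrm{CO}(n)$, $\mathcal P(n)$, respectively, with constant terms $0,0,0,1$. **Proposition.** As formal multilinear series (and hence also as formal power series in $g$, i.e. after setting all arguments equal to $g$ in every degree): 1. $B(g)=g+\tau(A(g))\,g+A(g)$. 2. The series $1-\tau(g)$ has a unique multiplicative inverse, and $C(g)=B\big(g/(1-\tau(g))\big)$, where $g/(1-\tau(g))$ is the series $(1-\tau(g))^{-1}g$, with $n$-th term $(g_1,\dots,g_n)\mapsto\tau(g_1)\cdots\tau(g_{n-1})\,g_n$. 3. $D(g)=1+C\big(g\,D(g)\big)$. 4. The series $1+C(h)$ has a unique multiplicative inverse, and $F(g)=g\,D(g)$ has exactly one (two-sided) inverse with respect to composition, namely $F^{\langle-1\rangle}(h)=h\,\big(1+C(h)\big)^{-1}$. -/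

import Mathlib

open MeasureTheory
open scoped BigOperators

namespace Vandermonde

open Classical in
/-- Helper: a finite set has finitely many partitions. -/
noncomputable instance instFintypeSetoidFin (n : ℕ) : Fintype (Setoid (Fin n)) :=
  Fintype.ofInjective (fun (π : Setoid (Fin n)) (p : Fin n × Fin n) => decide (π p.1 p.2)) (by
    intro π σ h
    ext a b
    have := congrFun h (a, b)
    simpa using this)

/-! ## Classes of set partitions

A partition `π` of `[n]` is a `Setoid (Fin n)`, where `π i j` says that `i` and `j` belong to the
same block; the element `i : Fin n` stands for the atom `i + 1` of `[n]`. -/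

/-- `S` splits `π`: `S` is a union of blocks of `π`. -/
def Splits {n : ℕ} (S : Set (Fin n)) (π : Setoid (Fin n)) : Prop :=
  ∀ i j, π i j → i ∈ S → j ∈ S

/-- `π` is connected: no proper subinterval `{p + 1, …, p + q}` of `[n]` splits `π`. -/
def IsConn {n : ℕ} (π : Setoid (Fin n)) : Prop :=
  ∀ p q : ℕ, 0 < q → p + q ≤ n → q < n → ¬ Splits {i : Fin n | p ≤ (i : ℕ) ∧ (i : ℕ) < p + q} π

/-- No block of `π` contains neighbors. -/
def NoNeighbors {n : ℕ} (π : Setoid (Fin n)) : Prop :=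
  ∀ i j : Fin n, (i : ℕ) + 1 = j → ¬ π i j

/-- The class `PC⁺(n)`: connected partitions without neighbors in a block. -/
def IsPCPlus {n : ℕ} (π : Setoid (Fin n)) : Prop :=
  IsConn π ∧ NoNeighbors π

/-- The purely crossing partitions of `[m + 1]`: moreover the first and the last atom lie in
different blocks. -/
def IsPC {m : ℕ} (π : Setoid (Fin (m + 1))) : Prop :=
  IsConn π ∧ NoNeighbors π ∧ ¬ π 0 (Fin.last m)

/-! ## The polytope of a partition

For a partition `π` of `[n]`, `n = m + 1`, the random Vandermonde matrices lead to the equations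
`∑_{j ∈ S} (t_j - t_{j-1}) = 0`, one for each block `S` of `π`, with indices cyclic, `t_0 = t_n`.
The number `t_j` (`1 ≤ j ≤ n`) is the value of `t : Fin (m + 1) → ℝ` at the atom `j`, and `t_0 = t_n`
is accounted for by the cyclic subtraction of `Fin (m + 1)`. -/

open Classical in
/-- The block equations `∑_{j ∈ S} t_j = ∑_{j ∈ S} t_{j-1}` for all blocks `S` of `π`. -/
def Balanced {m : ℕ} (π : Setoid (Fin (m + 1))) (t : Fin (m + 1) → ℝ) : Prop :=
  ∀ k, ∑ j with π j k, (t j - t (j - 1)) = 0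

/-- Indices of the free coordinates among `t_1, …, t_{n-1}`: the coordinate that precedes an atom is
free when this atom is not the least element of its block.  There are `n - |π|` of them, and
together with `t_n` they form coordinates (even of the lattice of integer points) on the
solution space of the block equations. -/
abbrev FreeIdx {m : ℕ} (π : Setoid (Fin (m + 1))) : Type :=
  {i : Fin m // ∃ k, k < i.succ ∧ π k i.succ}

open Classical in
noncomputable instance instFintypeFreeIdx {m : ℕ} (π : Setoid (Fin (m + 1))) :
    Fintype (FreeIdx π) := Fintype.ofFinite _

open Classical in
/-- Helper for `existsUnique_balanced`: the linear system that determines a solution. -/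
noncomputable def systemMap {m : ℕ} (π : Setoid (Fin (m + 1))) :
    (Fin (m + 1) → ℝ) →ₗ[ℝ] (Fin (m + 1) → ℝ) where
  toFun t := Fin.lastCases (t (Fin.last m)) (fun i =>
    if ∃ k, k < i.succ ∧ π k i.succ then t i.castSucc
    else ∑ j with π j i.succ, (t j - t (j - 1)))
  map_add' s t := by
    funext i
    refine Fin.lastCases ?_ (fun i => ?_) i
    · simp
    · simp only [Fin.lastCases_castSucc, Pi.add_apply]
      split_ifs
      · rfl
      · rw [← Finset.sum_add_distrib]
        exact Finset.sum_congr rfl fun j _ => by ring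
  map_smul' c t := by
    funext i
    refine Fin.lastCases ?_ (fun i => ?_) i
    · simp
    · simp only [Fin.lastCases_castSucc, Pi.smul_apply, smul_eq_mul, RingHom.id_apply]
      split_ifs
      · rfl
      · rw [Finset.mul_sum]
        exact Finset.sum_congr rfl fun j _ => by ring

theorem systemMap_injective {m : ℕ} (π : Setoid (Fin (m + 1))) :
    Function.Injective (systemMap π) := by
  classical
  rw [injective_iff_map_eq_zero]
  intro t ht
  have hlast : t (Fin.last m) = 0 := by
    have := congrFun ht (Fin.last m)
    simpa [systemMap] using this
  have key : ∀ d : ℕ, ∀ i : Fin (m + 1), m - (i : ℕ) = d → t i = 0 := by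
    intro d
    induction d using Nat.strong_induction_on with
    | _ d ih =>
      intro i
      refine Fin.lastCases ?_ (fun i => ?_) i
      · intro _; exact hlast
      · intro hd
        have hi : (i : ℕ) < m := i.2
        have hbig : ∀ j : Fin (m + 1), (i : ℕ) < j → t j = 0 := by
          intro j hj
          have hj' : (j : ℕ) ≤ m := Nat.lt_succ_iff.mp j.2
          refine ih (m - j) ?_ j rfl
          simp only [Fin.val_castSucc] at hd
          omega
        have h := congrFun ht i.castSucc
        simp only [systemMap, LinearMap.coe_mk, AddHom.coe_mk, Fin.lastCases_castSucc,
          Pi.zero_apply] at h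
        split_ifs at h with hf
        · exact h
        · rw [Finset.sum_eq_single i.succ] at h
          · have h1 : i.succ - 1 = i.castSucc := by
              rw [sub_eq_iff_eq_add]; exact (Fin.coeSucc_eq_succ).symm
            rw [h1, hbig i.succ (by simp)] at h
            linarith
          · intro j hj hne
            have hj2 : π j i.succ := by simpa using hj
            have hlt : i.succ < j := by
              rcases lt_trichotomy j i.succ with h' | h' | h'
              · exact absurd ⟨j, h', hj2⟩ hf
              · exact absurd h' hne
              · exact h'
            have hlt' : (i : ℕ) + 1 < j := by simpa [Fin.lt_def] using hlt
            obtain ⟨j', rfl⟩ : ∃ j' : Fin m, j = j'.succ :=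
              Fin.exists_succ_eq.mpr (fun h0 => by simp [h0] at hlt') |>.imp fun _ h => h.symm
            have h1 : j'.succ - 1 = j'.castSucc := by
              rw [sub_eq_iff_eq_add]; exact (Fin.coeSucc_eq_succ).symm
            rw [h1, hbig j'.succ (by omega), hbig j'.castSucc (by simpa using hlt'), sub_zero]
          · intro hn
            exact absurd (by simp) hn
  funext i
  exact key _ i rfl

/-- The block equations have exactly one solution with prescribed `t_n` and prescribed free
coordinates. -/
theorem existsUnique_balanced {m : ℕ} (π : Setoid (Fin (m + 1))) (x : ℝ) (u : FreeIdx π → ℝ) :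
    ∃! t : Fin (m + 1) → ℝ,
      Balanced π t ∧ t (Fin.last m) = x ∧ ∀ i : FreeIdx π, t i.1.castSucc = u i := by
  classical
  have hsurj : Function.Surjective (systemMap π) :=
    LinearMap.injective_iff_surjective.mp (systemMap_injective π)
  obtain ⟨t, ht⟩ := hsurj (Fin.lastCases x (fun i => if h : ∃ k, k < i.succ ∧ π k i.succ
    then u ⟨i, h⟩ else 0))
  have hlast : t (Fin.last m) = x := by
    simpa [systemMap] using congrFun ht (Fin.last m)
  have hfree : ∀ i : FreeIdx π, t i.1.castSucc = u i := by
    intro i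
    have := congrFun ht i.1.castSucc
    simpa [systemMap, i.2] using this
  have hdep : ∀ i : Fin m, (¬ ∃ k, k < i.succ ∧ π k i.succ) →
      ∑ j with π j i.succ, (t j - t (j - 1)) = 0 := by
    intro i hi
    have := congrFun ht i.castSucc
    simp only [systemMap, LinearMap.coe_mk, AddHom.coe_mk, Fin.lastCases_castSucc] at this
    rwa [if_neg hi, dif_neg hi] at this
  have hcongr : ∀ k l, π k l →
      ∑ j with π j k, (t j - t (j - 1)) = ∑ j with π j l, (t j - t (j - 1)) := by
    intro k l hkl
    refine Finset.sum_congr ?_ fun _ _ => rfl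
    ext j
    simp only [Finset.mem_filter, Finset.mem_univ, true_and]
    exact ⟨fun h => π.trans h hkl, fun h => π.trans h (π.symm hkl)⟩
  have hne0 : ∀ k, ¬ π k 0 → ∑ j with π j k, (t j - t (j - 1)) = 0 := by
    intro k hk
    have hne : (Finset.univ.filter fun j => π j k).Nonempty := ⟨k, by simp⟩
    have hmem := Finset.min'_mem _ hne
    set a := (Finset.univ.filter fun j => π j k).min' hne with ha
    have hak : π a k := by simpa using hmem
    have ha0 : a ≠ 0 := fun h => hk (h ▸ π.symm hak)
    obtain ⟨i, hi⟩ := Fin.exists_succ_eq.mpr ha0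
    rw [← hcongr a k hak, ← hi]
    refine hdep i ?_
    rintro ⟨b, hb, hbi⟩
    rw [hi] at hb hbi
    have : a ≤ b := Finset.min'_le _ _ (by simpa using π.trans hbi hak)
    exact absurd hb (not_lt.mpr this)
  have hbal : Balanced π t := by
    intro k
    by_cases hk : π k 0
    · rw [hcongr k 0 hk]
      have htot : ∑ j, (t j - t (j - 1)) = 0 := by
        rw [Finset.sum_sub_distrib, sub_eq_zero]
        exact (Equiv.sum_comp (Equiv.subRight (1 : Fin (m + 1))) t).symm
      rw [← Finset.sum_fiberwise (s := Finset.univ)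
        (g := fun j => (Quotient.mk π j : Quotient π))] at htot
      rw [Finset.sum_eq_single (Quotient.mk π 0)] at htot
      · rw [← htot]
        refine Finset.sum_congr ?_ fun _ _ => rfl
        ext j
        simp only [Finset.mem_filter, Finset.mem_univ, true_and]
        exact Quotient.eq.symm
      · intro q _ hq
        induction q using Quotient.inductionOn with
        | _ l =>
          have hl : ¬ π l 0 := fun h => hq (Quotient.sound h)
          rw [← hne0 l hl]
          refine Finset.sum_congr ?_ fun _ _ => rfl
          ext j
          simp only [Finset.mem_filter, Finset.mem_univ, true_and]
          exact Quotient.eq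
      · simp
    · exact hne0 k hk
  refine ⟨t, ⟨hbal, hlast, hfree⟩, ?_⟩
  rintro s ⟨hs1, hs2, hs3⟩
  apply systemMap_injective π
  funext i
  refine Fin.lastCases ?_ (fun i => ?_) i
  · simp [systemMap, hs2, hlast]
  · simp only [systemMap, LinearMap.coe_mk, AddHom.coe_mk, Fin.lastCases_castSucc]
    split_ifs with h
    · rw [hs3 ⟨i, h⟩, hfree ⟨i, h⟩]
    · rw [hs1 i.succ, hbal i.succ]

/-- The solution of the block equations of `π` with `t_n = x` and free coordinates `u`. -/
noncomputable def solution {m : ℕ} (π : Setoid (Fin (m + 1))) (x : ℝ) (u : FreeIdx π → ℝ) :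
    Fin (m + 1) → ℝ :=
  (existsUnique_balanced π x u).choose

theorem solution_spec {m : ℕ} (π : Setoid (Fin (m + 1))) (x : ℝ) (u : FreeIdx π → ℝ) :
    Balanced π (solution π x u) ∧ solution π x u (Fin.last m) = x ∧
      ∀ i : FreeIdx π, solution π x u i.1.castSucc = u i :=
  (existsUnique_balanced π x u).choose_spec.1

theorem eq_solution {m : ℕ} (π : Setoid (Fin (m + 1))) (x : ℝ) (u : FreeIdx π → ℝ)
    (t : Fin (m + 1) → ℝ) (h1 : Balanced π t) (h2 : t (Fin.last m) = x)
    (h3 : ∀ i : FreeIdx π, t i.1.castSucc = u i) : t = solution π x u :=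
  (existsUnique_balanced π x u).choose_spec.2 t ⟨h1, h2, h3⟩

/-- Helper: `solution` as a linear map. -/
noncomputable def solutionLin {m : ℕ} (π : Setoid (Fin (m + 1))) :
    (ℝ × (FreeIdx π → ℝ)) →ₗ[ℝ] (Fin (m + 1) → ℝ) where
  toFun p := solution π p.1 p.2
  map_add' p q := by
    symm
    obtain ⟨a1, a2, a3⟩ := solution_spec π p.1 p.2
    obtain ⟨b1, b2, b3⟩ := solution_spec π q.1 q.2
    refine eq_solution π _ _ _ (fun k => ?_) ?_ fun i => ?_
    · rw [← add_zero (0 : ℝ)]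
      nth_rewrite 1 [← a1 k]
      rw [← b1 k, ← Finset.sum_add_distrib]
      exact Finset.sum_congr rfl fun j _ => by simp only [Pi.add_apply]; ring
    · simp [a2, b2]
    · simp [a3, b3]
  map_smul' c p := by
    symm
    obtain ⟨a1, a2, a3⟩ := solution_spec π p.1 p.2
    refine eq_solution π _ _ _ (fun k => ?_) ?_ fun i => ?_
    · rw [← mul_zero c, ← a1 k, Finset.mul_sum]
      exact Finset.sum_congr rfl fun j _ => by
        simp only [Pi.smul_apply, smul_eq_mul, RingHom.id_apply]; ring
    · simp [a2]
    · simp [a3]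

theorem solution_const {m : ℕ} (π : Setoid (Fin (m + 1))) (c : ℝ) :
    solution π c (fun _ => c) = fun _ => c :=
  (eq_solution π c (fun _ => c) (fun _ => c) (fun k => by simp) rfl fun _ => rfl).symm

theorem continuous_solution {m : ℕ} (π : Setoid (Fin (m + 1))) :
    Continuous fun p : ℝ × (FreeIdx π → ℝ) => solution π p.1 p.2 :=
  (solutionLin π).continuous_of_finiteDimensional

/-! ## The multilinear maps `Λ_π` -/

/-- The algebra `C[0,1]` of continuous complex functions on the unit interval. -/
abbrev C01 : Type := C(unitInterval, ℂ)

open Classical in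
/-- The extension of a function on `[0,1]` by zero to the real line. -/
noncomputable def zeroExt (f : C01) (s : ℝ) : ℂ :=
  if h : s ∈ Set.Icc (0 : ℝ) 1 then f ⟨s, h⟩ else 0

/-- Helper: `zeroExt` as a linear map. -/
noncomputable def zeroExtLin (s : ℝ) : C01 →ₗ[ℂ] ℂ where
  toFun f := zeroExt f s
  map_add' f g := by unfold zeroExt; split_ifs <;> simp
  map_smul' c f := by unfold zeroExt; split_ifs <;> simp

theorem zeroExt_eq_indicator (f : C01) :
    zeroExt f = Set.indicator (Set.Icc (0 : ℝ) 1)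
      (fun s => f (Set.projIcc 0 1 zero_le_one s)) := by
  funext s
  by_cases h : s ∈ Set.Icc (0 : ℝ) 1
  · rw [Set.indicator_of_mem h, Set.projIcc_of_mem _ h, zeroExt, dif_pos h]
  · rw [Set.indicator_of_notMem h, zeroExt, dif_neg h]

theorem measurable_zeroExt (f : C01) : Measurable (zeroExt f) := by
  rw [zeroExt_eq_indicator]
  exact (f.continuous.comp continuous_projIcc).measurable.indicator measurableSet_Icc

theorem norm_zeroExt_le (f : C01) (s : ℝ) : ‖zeroExt f s‖ ≤ ‖f‖ := by
  unfold zeroExt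
  split_ifs
  · exact f.norm_coe_le_norm _
  · simp

theorem continuousAt_zeroExt (f : C01) (s : ℝ) (h0 : s ≠ 0) (h1 : s ≠ 1) :
    ContinuousAt (zeroExt f) s := by
  rw [zeroExt_eq_indicator]
  have hc : Continuous fun s => f (Set.projIcc 0 1 zero_le_one s) :=
    f.continuous.comp continuous_projIcc
  have hs : s ∉ frontier (Set.Icc (0 : ℝ) 1) := by
    rw [frontier_Icc zero_le_one]
    simp [h0, h1]
  exact hc.continuousOn.continuousAt_indicator hs

/-- The function integrated in the definition of `Λ_π(g_1, …, g_{n-1})(x)`: the product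
`g_1(t_1) ⋯ g_{n-1}(t_{n-1})` if all `t_i` lie in `[0,1]`, and zero otherwise, where `t` is the
solution of the block equations with `t_0 = t_n = x` and free coordinates `u`. -/
noncomputable def kernel {m : ℕ} (π : Setoid (Fin (m + 1))) (g : Fin m → C01) (x : ℝ)
    (u : FreeIdx π → ℝ) : ℂ :=
  ∏ i : Fin m, zeroExt (g i) (solution π x u i.castSucc)

/-- Helper: an integrable bound for the kernel. -/
noncomputable def kernelBound {m : ℕ} (π : Setoid (Fin (m + 1))) (g : Fin m → C01) :
    (FreeIdx π → ℝ) → ℝ :=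
  Set.indicator (Set.Icc 0 1) (fun _ => ∏ i, ‖g i‖)

theorem norm_kernel_le {m : ℕ} (π : Setoid (Fin (m + 1))) (g : Fin m → C01) (x : ℝ)
    (u : FreeIdx π → ℝ) : ‖kernel π g x u‖ ≤ kernelBound π g u := by
  unfold kernelBound
  by_cases hu : u ∈ Set.Icc (0 : FreeIdx π → ℝ) 1
  · rw [Set.indicator_of_mem hu, kernel, norm_prod]
    exact Finset.prod_le_prod (fun _ _ => norm_nonneg _) fun i _ => norm_zeroExt_le _ _
  · rw [Set.indicator_of_notMem hu]
    have : ∃ i, u i ∉ Set.Icc (0 : ℝ) 1 := by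
      by_contra! h
      exact hu ⟨fun i => (h i).1, fun i => (h i).2⟩
    obtain ⟨i, hi⟩ := this
    rw [kernel, Finset.prod_eq_zero (Finset.mem_univ i.1), norm_zero]
    rw [(solution_spec π x u).2.2 i, zeroExt, dif_neg hi]

theorem integrable_kernelBound {m : ℕ} (π : Setoid (Fin (m + 1))) (g : Fin m → C01) :
    Integrable (kernelBound π g) := by
  refine (integrable_indicator_iff measurableSet_Icc).mpr ?_
  refine integrableOn_const ?_
  rw [Real.volume_Icc_pi]
  simp

theorem integral_kernelBound {m : ℕ} (π : Setoid (Fin (m + 1))) (g : Fin m → C01) :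
    ∫ u, kernelBound π g u = ∏ i, ‖g i‖ := by
  unfold kernelBound
  rw [integral_indicator measurableSet_Icc, setIntegral_const, measureReal_def,
    Real.volume_Icc_pi]
  simp

theorem measurable_kernel {m : ℕ} (π : Setoid (Fin (m + 1))) (g : Fin m → C01) (x : ℝ) :
    Measurable (kernel π g x) := by
  unfold kernel
  refine Finset.measurable_prod _ fun i _ => (measurable_zeroExt (g i)).comp ?_
  have h : Continuous fun u : FreeIdx π → ℝ => solution π x u :=
    (continuous_solution π).comp (Continuous.prodMk continuous_const continuous_id)
  exact ((continuous_apply i.castSucc).comp h).measurable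

theorem integrable_kernel {m : ℕ} (π : Setoid (Fin (m + 1))) (g : Fin m → C01) (x : ℝ) :
    Integrable (kernel π g x) :=
  (integrable_kernelBound π g).mono' (measurable_kernel π g x).aestronglyMeasurable
    (Filter.Eventually.of_forall (norm_kernel_le π g x))

theorem ae_ne_of_linear {m : ℕ} {π : Setoid (Fin (m + 1))} (φ : (FreeIdx π → ℝ) →ₗ[ℝ] ℝ)
    (hφ : φ ≠ 0) (c : ℝ) : ∀ᵐ u : FreeIdx π → ℝ, φ u ≠ c := by
  let S : AffineSubspace ℝ (FreeIdx π → ℝ) :=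
    { carrier := {u | φ u = c}
      smul_vsub_vadd_mem' := by
        intro a p q r hp hq hr
        simp only [Set.mem_ofPred_eq] at hp hq hr ⊢
        simp [hp, hq, hr] }
  have hS : S ≠ ⊤ := by
    intro h
    have hall : ∀ u, φ u = c := by
      intro u
      have : u ∈ S := h ▸ AffineSubspace.mem_top ℝ _ u
      exact this
    have hc : c = 0 := by rw [← hall 0, map_zero]
    exact hφ (LinearMap.ext fun u => by rw [hall u, hc]; rfl)
  have := Measure.addHaar_affineSubspace (volume : Measure (FreeIdx π → ℝ)) S hS
  have hset : {u : FreeIdx π → ℝ | ¬ φ u ≠ c} = (S : Set (FreeIdx π → ℝ)) := by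
    ext u
    exact not_ne_iff
  rw [ae_iff, hset]
  exact this

theorem continuous_integral_kernel {m : ℕ} (π : Setoid (Fin (m + 1))) (g : Fin m → C01) :
    Continuous fun x : unitInterval => ∫ u, kernel π g x u := by
  rw [continuous_iff_continuousAt]
  intro x₀
  refine continuousAt_of_dominated
    (Filter.Eventually.of_forall fun x => (measurable_kernel π g x).aestronglyMeasurable)
    (Filter.Eventually.of_forall fun x => Filter.Eventually.of_forall (norm_kernel_le π g x))
    (integrable_kernelBound π g) ?_
  have hlin : ∀ (x : ℝ) (u : FreeIdx π → ℝ) (i : Fin (m + 1)),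
      solution π x u i = solution π x 0 i + solution π 0 u i := by
    intro x u i
    have := congrFun ((solutionLin π).map_add (x, 0) (0, u)) i
    simpa [solutionLin] using this
  have hfac : ∀ i : Fin m, ∀ᵐ u : FreeIdx π → ℝ, ContinuousAt
      (fun x : unitInterval => zeroExt (g i) (solution π x u i.castSucc)) x₀ := by
    intro i
    let φ : (FreeIdx π → ℝ) →ₗ[ℝ] ℝ :=
      (LinearMap.proj i.castSucc ∘ₗ solutionLin π) ∘ₗ LinearMap.inr ℝ ℝ (FreeIdx π → ℝ)
    have hφu : ∀ u, φ u = solution π 0 u i.castSucc := fun u => rfl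
    by_cases hφ : φ = 0
    · refine Filter.Eventually.of_forall fun u => ?_
      have hx : ∀ x : unitInterval, solution π x u i.castSucc = x := by
        intro x
        have h1 := congrFun (solution_const π (x : ℝ)) i.castSucc
        rw [hlin, ← hφu, hφ] at h1
        rw [hlin, ← hφu, hφ]
        exact h1
      have : (fun x : unitInterval => zeroExt (g i) (solution π x u i.castSucc)) = g i := by
        funext x
        rw [hx, zeroExt, dif_pos x.2]
      rw [this]
      exact (g i).continuous.continuousAt
    · filter_upwards [ae_ne_of_linear φ hφ (0 - solution π x₀ 0 i.castSucc),
        ae_ne_of_linear φ hφ (1 - solution π x₀ 0 i.castSucc)] with u h0 h1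
      have hc : Continuous fun x : unitInterval => solution π x u i.castSucc :=
        (continuous_apply i.castSucc).comp ((continuous_solution π).comp
          (Continuous.prodMk continuous_subtype_val continuous_const))
      refine ContinuousAt.comp (g := zeroExt (g i)) (continuousAt_zeroExt _ _ ?_ ?_)
        hc.continuousAt
      · rw [hlin, ← hφu]
        intro h
        exact h0 (by linarith)
      · rw [hlin, ← hφu]
        intro h
        exact h1 (by linarith)
  filter_upwards [ae_all_iff.mpr hfac] with u hu
  unfold kernel
  exact tendsto_finsetProd _ fun i _ => hu i

/-- `Λ_π(g_1, …, g_{n-1}) ∈ C[0,1]`: its value at `x` is the integral of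
`g_1(t_1) ⋯ g_{n-1}(t_{n-1})` over the polytope of all `t ∈ [0,1]^n` with `t_n = x` that satisfy the
block equations of `π`, with respect to Lebesgue measure in the free coordinates. -/
noncomputable def LambdaFun {m : ℕ} (π : Setoid (Fin (m + 1))) (g : Fin m → C01) : C01 where
  toFun x := ∫ u : FreeIdx π → ℝ, kernel π g x u
  continuous_toFun := continuous_integral_kernel π g

theorem norm_LambdaFun_le {m : ℕ} (π : Setoid (Fin (m + 1))) (g : Fin m → C01) :
    ‖LambdaFun π g‖ ≤ 1 * ∏ i, ‖g i‖ := by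
  rw [one_mul, ContinuousMap.norm_le _ (Finset.prod_nonneg fun _ _ => norm_nonneg _)]
  intro x
  rw [← integral_kernelBound π g]
  exact norm_integral_le_of_norm_le (integrable_kernelBound π g)
    (Filter.Eventually.of_forall (norm_kernel_le π g x))

/-- `Λ_π` as a bounded multilinear map from `n - 1` copies of `C[0,1]` to `C[0,1]`. -/
noncomputable def Lambda {m : ℕ} (π : Setoid (Fin (m + 1))) :
    ContinuousMultilinearMap ℂ (fun _ : Fin m => C01) C01 :=
  MultilinearMap.mkContinuous
    { toFun := LambdaFun π
      map_update_add' := by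
        intro inst g i a b
        obtain rfl : inst = instDecidableEqFin m := Subsingleton.elim _ _
        ext x
        change ∫ u, kernel π _ x u = (∫ u, kernel π _ x u) + ∫ u, kernel π _ x u
        rw [← integral_add (integrable_kernel π _ x) (integrable_kernel π _ x)]
        refine integral_congr_ae (Filter.Eventually.of_forall fun u => ?_)
        exact ((MultilinearMap.mkPiAlgebra ℂ (Fin m) ℂ).compLinearMap
          fun i => zeroExtLin (solution π x u i.castSucc)).map_update_add g i a b
      map_update_smul' := by
        intro inst g i c a
        obtain rfl : inst = instDecidableEqFin m := Subsingleton.elim _ _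
        ext x
        change ∫ u, kernel π _ x u = c • ∫ u, kernel π _ x u
        rw [← integral_smul]
        refine integral_congr_ae (Filter.Eventually.of_forall fun u => ?_)
        exact ((MultilinearMap.mkPiAlgebra ℂ (Fin m) ℂ).compLinearMap
          fun i => zeroExtLin (solution π x u i.castSucc)).map_update_smul g i c a }
    1 (norm_LambdaFun_le π)

/-! ## The trace -/

theorem integrable_C01 (f : C01) : Integrable (fun y : unitInterval => f y) :=
  f.continuous.integrable_of_hasCompactSupport (HasCompactSupport.of_compactSpace f)

/-- The trace `τ` on `C[0,1]`: integration with respect to Lebesgue measure. -/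
noncomputable def tau : C01 →L[ℂ] ℂ :=
  LinearMap.mkContinuous
    { toFun := fun f => ∫ y : unitInterval, f y
      map_add' := fun f g => integral_add (integrable_C01 f) (integrable_C01 g)
      map_smul' := fun c f => integral_smul c fun y : unitInterval => f y }
    1 (by
      intro f
      have := norm_integral_le_of_norm_le_const (μ := (volume : Measure unitInterval))
        (Filter.Eventually.of_forall fun y => f.norm_coe_le_norm y)
      simpa using this)

/-! ## Formal multilinear series in a variable `g ∈ C[0,1]`

The `n`-th term of such a series is an `n`-linear map `C[0,1]^n → C[0,1]`; evaluating it at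
`(g, …, g)` gives the term of degree `n` of the formal power series in `g`.  Sums and
compositions are those of Mathlib. -/

/-- Formal multilinear series over `C[0,1]`. -/
abbrev Ser : Type := FormalMultilinearSeries ℂ C01 C01

/-- Helper for the product of series: `(v_1, …, v_n) ↦ f(v_1, …, v_k) f'(v_{k+1}, …, v_n)`. -/
noncomputable def concatMul {k l n : ℕ} (h : k + l = n)
    (f : ContinuousMultilinearMap ℂ (fun _ : Fin k => C01) C01)
    (f' : ContinuousMultilinearMap ℂ (fun _ : Fin l => C01) C01) :
    ContinuousMultilinearMap ℂ (fun _ : Fin n => C01) C01 where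
  toFun v := f (fun i => v (Fin.cast h (Fin.castAdd l i))) *
    f' (fun i => v (Fin.cast h (Fin.natAdd k i)))
  map_update_add' := by
    intro inst v i a b
    obtain rfl : inst = instDecidableEqFin n := Subsingleton.elim _ _
    subst h
    refine Fin.addCases (fun i => ?_) (fun i => ?_) i
    · have e1 : ∀ c : C01, (fun j => Function.update v (Fin.castAdd l i) c
          (Fin.cast rfl (Fin.castAdd l j))) =
          Function.update (fun j => v (Fin.castAdd l j)) i c := fun c => by
        funext j
        by_cases hj : j = i
        · subst hj; simp
        · simp [hj]
      have e2 : ∀ c : C01, (fun j => Function.update v (Fin.castAdd l i) c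
          (Fin.cast rfl (Fin.natAdd k j))) = fun j => v (Fin.natAdd k j) := fun c => by
        funext j
        have : Fin.natAdd k j ≠ Fin.castAdd l i := by
          intro h; have := congrArg Fin.val h; have := i.2; simp at *; omega
        simp [this]
      rw [e1, e1, e1, e2, e2, e2, f.map_update_add, add_mul]
    · have e1 : ∀ c : C01, (fun j => Function.update v (Fin.natAdd k i) c
          (Fin.cast rfl (Fin.natAdd k j))) =
          Function.update (fun j => v (Fin.natAdd k j)) i c := fun c => by
        funext j
        by_cases hj : j = i
        · subst hj; simp
        · simp [hj]
      have e2 : ∀ c : C01, (fun j => Function.update v (Fin.natAdd k i) c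
          (Fin.cast rfl (Fin.castAdd l j))) = fun j => v (Fin.castAdd l j) := fun c => by
        funext j
        have : Fin.castAdd l j ≠ Fin.natAdd k i := by
          intro h; have := congrArg Fin.val h; have := j.2; simp at *; omega
        simp [this]
      rw [e1, e1, e1, e2, e2, e2, f'.map_update_add, mul_add]
  map_update_smul' := by
    intro inst v i a b
    obtain rfl : inst = instDecidableEqFin n := Subsingleton.elim _ _
    subst h
    refine Fin.addCases (fun i => ?_) (fun i => ?_) i
    · have e1 : ∀ c : C01, (fun j => Function.update v (Fin.castAdd l i) c
          (Fin.cast rfl (Fin.castAdd l j))) =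
          Function.update (fun j => v (Fin.castAdd l j)) i c := fun c => by
        funext j
        by_cases hj : j = i
        · subst hj; simp
        · simp [hj]
      have e2 : ∀ c : C01, (fun j => Function.update v (Fin.castAdd l i) c
          (Fin.cast rfl (Fin.natAdd k j))) = fun j => v (Fin.natAdd k j) := fun c => by
        funext j
        have : Fin.natAdd k j ≠ Fin.castAdd l i := by
          intro h; have := congrArg Fin.val h; have := i.2; simp at *; omega
        simp [this]
      rw [e1, e1, e2, e2, f.map_update_smul, smul_mul_assoc]
    · have e1 : ∀ c : C01, (fun j => Function.update v (Fin.natAdd k i) c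
          (Fin.cast rfl (Fin.natAdd k j))) =
          Function.update (fun j => v (Fin.natAdd k j)) i c := fun c => by
        funext j
        by_cases hj : j = i
        · subst hj; simp
        · simp [hj]
      have e2 : ∀ c : C01, (fun j => Function.update v (Fin.natAdd k i) c
          (Fin.cast rfl (Fin.castAdd l j))) = fun j => v (Fin.castAdd l j) := fun c => by
        funext j
        have : Fin.castAdd l j ≠ Fin.natAdd k i := by
          intro h; have := congrArg Fin.val h; have := j.2; simp at *; omega
        simp [this]
      rw [e1, e1, e2, e2, f'.map_update_smul, mul_smul_comm]
  cont := by fun_prop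

/-- The product of series:
`(p q)_n(v_1, …, v_n) = ∑_{k=0}^n p_k(v_1, …, v_k) q_{n-k}(v_{k+1}, …, v_n)`. -/
noncomputable def serMul (p q : Ser) : Ser := fun n =>
  ∑ k : Fin (n + 1), concatMul (Nat.add_sub_cancel' (Nat.lt_succ_iff.mp k.2)) (p k) (q (n - k))

/-- The constant series `1`. -/
noncomputable def serOne : Ser := constFormalMultilinearSeries ℂ C01 (1 : C01)

/-- The series `g`, that is, the neutral element for composition. -/
noncomputable def serVar : Ser := FormalMultilinearSeries.id ℂ C01 0

/-- The series `τ(P(g))`, with scalars regarded as constant functions. -/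
noncomputable def serTau (p : Ser) : Ser :=
  (tau.smulRight (1 : C01)).compFormalMultilinearSeries p

/-- `r` is the multiplicative inverse of the series `p`. -/
def IsMulInverse (p r : Ser) : Prop := serMul p r = serOne ∧ serMul r p = serOne

/-- `q` is the inverse of the series `p` with respect to composition. -/
def IsCompInverse (p q : Ser) : Prop := p.comp q = serVar ∧ q.comp p = serVar

/-- The `n`-linear map `(g_1, …, g_n) ↦ Λ_π(g_1, …, g_{n-1}) g_n`, for `n = m + 1`. -/
noncomputable def LambdaMul {m : ℕ} (π : Setoid (Fin (m + 1))) :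
    ContinuousMultilinearMap ℂ (fun _ : Fin (m + 1) => C01) C01 :=
  ((ContinuousLinearMap.mul ℂ C01).compContinuousMultilinearMap (Lambda π)).uncurryRight

theorem LambdaMul_apply {m : ℕ} (π : Setoid (Fin (m + 1))) (v : Fin (m + 1) → C01) :
    LambdaMul π v = Lambda π (fun i => v i.castSucc) * v (Fin.last m) := rfl

open Classical in
/-- The series `A`: sums over the purely crossing partitions. -/
noncomputable def serA : Ser
  | 0 => 0
  | m + 1 => ∑ π : Setoid (Fin (m + 1)) with IsPC π, LambdaMul π

open Classical in
/-- The series `B`: sums over `PC⁺(n)`. -/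
noncomputable def serB : Ser
  | 0 => 0
  | m + 1 => ∑ π : Setoid (Fin (m + 1)) with IsPCPlus π, LambdaMul π

open Classical in
/-- The series `C`: sums over the connected partitions. -/
noncomputable def serC : Ser
  | 0 => 0
  | m + 1 => ∑ π : Setoid (Fin (m + 1)) with IsConn π, LambdaMul π

/-- The series `D`: constant term `1`, and sums over all partitions. -/
noncomputable def serD : Ser
  | 0 => serOne 0
  | m + 1 => ∑ π : Setoid (Fin (m + 1)), LambdaMul π

end Vandermonde

namespace Vandermonde

/-! ## The maps `Λ_π` of glued partitions -/

/-! Three surgeries on a partition carry the analytic content; each rests on the unique solvability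
of the block equations (`eq_solution`) and Fubini. (a) If an interval right after the atom `a` is a
union of blocks, its equations telescope: the last coordinate of the interval equals `t_a`. The
interval is then a separate system with base point `t_a`, and integrating it out multiplies `v_a` by
the function belonging to the inner partition (`LambdaMul_gap`). (b) If `a` and `a + 1` share a
block, `t_a` cancels from the equations, ranges freely over `[0,1]` and contributes `τ(v_a)`
(`LambdaMul_neighbors`). (c) If the first and the last atom share a block, the base point `x`
cancels. The preceding coordinate becomes the base point of the reduced system and is integrated,
which leaves a scalar times `v_n` (`LambdaMul_last`).

The equation for `B` is (c), after splitting `PC⁺` according to whether the first and the last atom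
are related. The equations for `C` and `D` use classes that interpolate atom by atom: `NoGap a` runs
from all partitions to the connected ones, `ConnNoNeighborsUpTo a` from the connected ones to `PC⁺`.
Passing from `a` to `a + 1` is (a), applied to the longest splitting interval after `a`,
respectively (b). To match these steps with the composition of series, a series is read as a
function of words, and composition becomes a recursion on the word: a letter joins the current block
or starts a new one (`compAux`). Induction on the unprocessed letters then gives
`classSum_noGap_eq_comp` and `classSum_eq_comp_serB`.

The inversion formula is algebra: `D = (1 + C) ∘ F` shows that `r ∘ F` inverts `D` if `r` inverts `1
+ C`. Hence `(h r(h)) ∘ F = g D (r ∘ F) = g`, and a left inverse of `F` must agree with the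
two-sided inverse that `F` has as a series without constant term and with identity linear term. -/

theorem integral_sumElim {α β γ : Type*} [Fintype α] [Fintype β] [Fintype γ] (e : α ⊕ β ≃ γ)
    (Φ : (γ → ℝ) → ℂ) (hΦ : Integrable Φ) :
    ∫ u, Φ u = ∫ a : α → ℝ, ∫ b : β → ℝ, Φ (Sum.elim a b ∘ e.symm) := by
  have h1 := volume_measurePreserving_piCongrLeft (fun _ : γ => ℝ) e
  have h2 := volume_measurePreserving_sumPiEquivProdPi_symm (fun _ : α ⊕ β => ℝ)
  have h := h1.comp h2
  have heq : ∀ p : (α → ℝ) × (β → ℝ), (MeasurableEquiv.piCongrLeft (fun _ : γ => ℝ) e ∘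
      (MeasurableEquiv.sumPiEquivProdPi (fun _ : α ⊕ β => ℝ)).symm) p =
      Sum.elim p.1 p.2 ∘ e.symm := by
    intro p
    funext c
    obtain ⟨c, rfl⟩ := e.surjective c
    rcases c with c | c <;>
      simp [MeasurableEquiv.coe_piCongrLeft, MeasurableEquiv.coe_sumPiEquivProdPi_symm]
  have hemb : MeasurableEmbedding (MeasurableEquiv.piCongrLeft (fun _ : γ => ℝ) e ∘
      (MeasurableEquiv.sumPiEquivProdPi (fun _ : α ⊕ β => ℝ)).symm) :=
    (MeasurableEquiv.measurableEmbedding _).comp (MeasurableEquiv.measurableEmbedding _)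
  rw [← h.integral_comp hemb]
  simp_rw [heq]
  have hint := (h.integrable_comp_emb hemb).mpr hΦ
  exact integral_prod (fun p : (α → ℝ) × (β → ℝ) => Φ (Sum.elim p.1 p.2 ∘ e.symm))
    (hint.congr (Filter.Eventually.of_forall fun p => congrArg Φ (heq p)))

theorem integral_sumElim_unit {α γ : Type*} [Fintype α] [Fintype γ] (e : α ⊕ Unit ≃ γ)
    (Φ : (γ → ℝ) → ℂ) (hΦ : Integrable Φ) :
    ∫ u, Φ u = ∫ y : ℝ, ∫ a : α → ℝ, Φ (Sum.elim a (fun _ => y) ∘ e.symm) := by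
  rw [integral_sumElim ((Equiv.sumComm Unit α).trans e) Φ hΦ,
    ← ((volume_preserving_funUnique Unit ℝ).symm _).integral_comp
      (MeasurableEquiv.measurableEmbedding _)]
  refine integral_congr_ae (Filter.Eventually.of_forall fun y => ?_)
  refine integral_congr_ae (Filter.Eventually.of_forall fun a => ?_)
  refine congrArg Φ ?_
  funext c
  obtain ⟨c, rfl⟩ := e.surjective c
  rcases c with c | c <;> simp

theorem zeroExt_mul (f g : C01) (s : ℝ) : zeroExt (f * g) s = zeroExt f s * zeroExt g s := by
  unfold zeroExt
  split_ifs <;> simp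

theorem zeroExt_of_notMem (f : C01) {s : ℝ} (h : s ∉ Set.Icc (0 : ℝ) 1) : zeroExt f s = 0 :=
  dif_neg h

theorem ext_zeroExt {f g : C01} (h : ∀ s ∈ Set.Icc (0 : ℝ) 1, zeroExt f s = zeroExt g s) :
    f = g := by
  ext x
  have := h x x.2
  rwa [zeroExt, zeroExt, dif_pos x.2, dif_pos x.2] at this

theorem tau_eq_integral_zeroExt (f : C01) : tau f = ∫ y : ℝ, zeroExt f y := by
  change ∫ y : unitInterval, f y = _
  rw [zeroExt_eq_indicator, integral_indicator measurableSet_Icc]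
  have := integral_subtype_comap (μ := (volume : Measure ℝ)) (s := Set.Icc (0 : ℝ) 1)
    measurableSet_Icc (fun s => f (Set.projIcc 0 1 zero_le_one s))
  rw [← this]
  refine integral_congr_ae (Filter.Eventually.of_forall fun y => ?_)
  simp

/-- The product of all `v_i(t_i)`, including the factor at the base point. -/
noncomputable def fullKernel {m : ℕ} (π : Setoid (Fin (m + 1))) (v : Fin (m + 1) → C01) (x : ℝ)
    (u : FreeIdx π → ℝ) : ℂ :=
  ∏ i, zeroExt (v i) (solution π x u i)

theorem fullKernel_eq {m : ℕ} (π : Setoid (Fin (m + 1))) (v : Fin (m + 1) → C01) (x : ℝ)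
    (u : FreeIdx π → ℝ) :
    fullKernel π v x u = kernel π (fun i => v i.castSucc) x u * zeroExt (v (Fin.last m)) x := by
  rw [fullKernel, Fin.prod_univ_castSucc, (solution_spec π x u).2.1]
  rfl

theorem integrable_fullKernel {m : ℕ} (π : Setoid (Fin (m + 1))) (v : Fin (m + 1) → C01) (x : ℝ) :
    Integrable (fullKernel π v x) := by
  simp_rw [funext (fullKernel_eq π v x)]
  exact (integrable_kernel π _ x).mul_const _

theorem zeroExt_LambdaMul {m : ℕ} (π : Setoid (Fin (m + 1))) (v : Fin (m + 1) → C01) (x : ℝ) :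
    zeroExt (LambdaMul π v) x = ∫ u, fullKernel π v x u := by
  simp_rw [fullKernel_eq, integral_mul_const, LambdaMul_apply, zeroExt_mul]
  by_cases hx : x ∈ Set.Icc (0 : ℝ) 1
  · congr 1
    rw [zeroExt, dif_pos hx]
    rfl
  · simp [zeroExt_of_notMem _ hx]

theorem LambdaMul_one (π : Setoid (Fin 1)) (v : Fin 1 → C01) : LambdaMul π v = v 0 := by
  have : IsEmpty (FreeIdx π) := ⟨fun i => i.1.elim0⟩
  refine ext_zeroExt fun x _ => ?_
  rw [zeroExt_LambdaMul, integral_unique]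
  -- Without free coordinates the domain is a single point of mass `1`.
  have : (volume : Measure (FreeIdx π → ℝ)).real Set.univ = 1 := by
    rw [volume_pi, measureReal_def, Measure.pi_of_empty]; simp
  rw [this, one_smul, fullKernel, Fin.prod_univ_one]
  congr 1
  exact (solution_spec π x _).2.1

/-- Combinatorial data for the removal of an interval of `q + 1` atoms after the atom `a`. -/
structure IsGap {m m' q : ℕ} (e : Fin (m' + 1) ⊕ Fin (q + 1) ≃ Fin (m + 1))
    (a : Fin (m' + 1)) : Prop where
  outer : ∀ i : Fin (m' + 1),
    ((e (Sum.inl i) : Fin (m + 1)) : ℕ) = if (i : ℕ) ≤ a then (i : ℕ) else i + (q + 1)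
  inner : ∀ j : Fin (q + 1), ((e (Sum.inr j) : Fin (m + 1)) : ℕ) = a + 1 + j

namespace IsGap

variable {m m' q : ℕ} {e : Fin (m' + 1) ⊕ Fin (q + 1) ≃ Fin (m + 1)} {a : Fin (m' + 1)}

theorem card_eq (e : Fin (m' + 1) ⊕ Fin (q + 1) ≃ Fin (m + 1)) : m = m' + q + 1 := by
  have := Fintype.card_congr e
  simp at this
  omega

/-- Predecessors are cyclic: if the gap lies at the end, the outer atom that follows it is the first
atom, and `i - 1 = a` covers this case too. -/
theorem outer_sub_one (h : IsGap e a) (i : Fin (m' + 1)) :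
    e (Sum.inl i) - 1 = if i - 1 = a then e (Sum.inr (Fin.last q)) else e (Sum.inl (i - 1)) := by
  have hm := card_eq e
  have h1 := h.outer (i - 1)
  have h2 := h.outer i
  have h3 := h.inner (Fin.last q)
  have hz : ∀ {n : ℕ} (k : Fin (n + 1)), k = 0 ↔ (k : ℕ) = 0 := fun k => Fin.ext_iff
  have ha := a.2
  have hi := i.2
  have hia : i - 1 = a ↔ (if (i : ℕ) = 0 then m' else (i : ℕ) - 1) = a := by
    rw [Fin.ext_iff, Fin.coe_sub_one]
    simp only [hz]
  rw [Fin.ext_iff, Fin.coe_sub_one, apply_ite Fin.val, h1, h3]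
  simp only [hia, hz, h2, Fin.coe_sub_one, Fin.val_last]
  by_cases h0 : (i : ℕ) = 0
  · simp only [h0, if_true]
    clear h1 h2 h3 hia
    grind
  · simp only [h0, if_false]
    clear h1 h2 h3 hia
    grind

theorem inner_sub_one (h : IsGap e a) (j : Fin (q + 1)) :
    e (Sum.inr j) - 1 = if j = 0 then e (Sum.inl a) else e (Sum.inr (j - 1)) := by
  have h1 := h.inner j
  have hz : ∀ {n : ℕ} (k : Fin (n + 1)), k = 0 ↔ (k : ℕ) = 0 := fun k => Fin.ext_iff
  rw [Fin.ext_iff, Fin.coe_sub_one, apply_ite Fin.val, h.outer, h.inner (j - 1)]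
  simp only [hz, h1, Fin.coe_sub_one]
  split_ifs <;> omega

theorem apply_last (h : IsGap e a) :
    Fin.last m = if a = Fin.last m' then e (Sum.inr (Fin.last q))
      else e (Sum.inl (Fin.last m')) := by
  have hm := card_eq e
  have h1 := h.outer (Fin.last m')
  have h2 := h.inner (Fin.last q)
  have := a.2
  have hv : a = Fin.last m' ↔ (a : ℕ) = m' := by rw [Fin.ext_iff]; rfl
  rw [Fin.ext_iff]
  simp only [Fin.val_last] at *
  split_ifs with c
  · omega
  · rw [h1]; rw [if_neg (by omega)]; omega

theorem outer_lt (h : IsGap e a) {i j : Fin (m' + 1)} :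
    e (Sum.inl i) < e (Sum.inl j) ↔ i < j := by
  rw [Fin.lt_def, Fin.lt_def, h.outer, h.outer]
  split_ifs <;> omega

theorem inner_lt (h : IsGap e a) {i j : Fin (q + 1)} :
    e (Sum.inr i) < e (Sum.inr j) ↔ i < j := by
  rw [Fin.lt_def, Fin.lt_def, h.inner, h.inner]
  omega

end IsGap

/-- The atoms that are not least in their blocks. -/
abbrev NonMin {m : ℕ} (π : Setoid (Fin (m + 1))) : Type :=
  {j : Fin (m + 1) // ∃ k, k < j ∧ π k j}

/-- A free coordinate is determined by the atom that follows it. -/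
noncomputable def freeIdxEquivNonMin {m : ℕ} (π : Setoid (Fin (m + 1))) :
    FreeIdx π ≃ NonMin π :=
  Equiv.ofBijective (fun i => ⟨i.1.succ, i.2⟩) (by
    constructor
    · intro i j h
      exact Subtype.ext (Fin.succ_injective _ (congrArg Subtype.val h))
    · rintro ⟨j, k, hk, hkj⟩
      obtain ⟨i, rfl⟩ := Fin.exists_succ_eq.mpr (Fin.ne_zero_of_lt hk)
      exact ⟨⟨i, k, hk, hkj⟩, rfl⟩)

theorem castSucc_eq_succ_sub_one {m : ℕ} (i : Fin m) : i.castSucc = i.succ - 1 := by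
  rw [eq_sub_iff_add_eq]
  exact Fin.coeSucc_eq_succ

theorem castSucc_freeIdxEquivNonMin_symm {m : ℕ} (π : Setoid (Fin (m + 1))) (j : NonMin π) :
    ((freeIdxEquivNonMin π).symm j).1.castSucc = j.1 - 1 := by
  obtain ⟨i, rfl⟩ := (freeIdxEquivNonMin π).surjective j
  rw [Equiv.symm_apply_apply, castSucc_eq_succ_sub_one]
  rfl

/-! ### Surgery (a): an interval that is a union of blocks -/

section Gap

variable {m m' q : ℕ} {e : Fin (m' + 1) ⊕ Fin (q + 1) ≃ Fin (m + 1)} {a : Fin (m' + 1)}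
  {π : Setoid (Fin (m + 1))} {σ : Setoid (Fin (m' + 1))} {ρ : Setoid (Fin (q + 1))}

theorem nonMin_inl (h : IsGap e a) (hσ : ∀ i j, π (e (Sum.inl i)) (e (Sum.inl j)) ↔ σ i j)
    (hn : ∀ i j, ¬ π (e (Sum.inl i)) (e (Sum.inr j))) (i : Fin (m' + 1)) :
    (∃ k, k < e (Sum.inl i) ∧ π k (e (Sum.inl i))) ↔ ∃ k, k < i ∧ σ k i := by
  constructor
  · rintro ⟨k, hk, hki⟩
    obtain ⟨k | k, rfl⟩ := e.surjective k
    · exact ⟨k, h.outer_lt.mp hk, (hσ _ _).mp hki⟩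
    · exact absurd (π.symm hki) (hn _ _)
  · rintro ⟨k, hk, hki⟩
    exact ⟨_, h.outer_lt.mpr hk, (hσ _ _).mpr hki⟩

theorem nonMin_inr (h : IsGap e a) (hρ : ∀ i j, π (e (Sum.inr i)) (e (Sum.inr j)) ↔ ρ i j)
    (hn : ∀ i j, ¬ π (e (Sum.inl i)) (e (Sum.inr j))) (i : Fin (q + 1)) :
    (∃ k, k < e (Sum.inr i) ∧ π k (e (Sum.inr i))) ↔ ∃ k, k < i ∧ ρ k i := by
  constructor
  · rintro ⟨k, hk, hki⟩
    obtain ⟨k | k, rfl⟩ := e.surjective k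
    · exact absurd hki (hn _ _)
    · exact ⟨k, h.inner_lt.mp hk, (hρ _ _).mp hki⟩
  · rintro ⟨k, hk, hki⟩
    exact ⟨_, h.inner_lt.mpr hk, (hρ _ _).mpr hki⟩

/-- Whether a coordinate is free depends on the atom after it, and `e` is increasing on both
summands, so least elements of blocks are preserved. The coordinate before an outer atom may lie in
the gap, hence the description by `e _ - 1`. -/
theorem exists_freeIdx_equiv (h : IsGap e a)
    (hσ : ∀ i j, π (e (Sum.inl i)) (e (Sum.inl j)) ↔ σ i j)
    (hρ : ∀ i j, π (e (Sum.inr i)) (e (Sum.inr j)) ↔ ρ i j)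
    (hn : ∀ i j, ¬ π (e (Sum.inl i)) (e (Sum.inr j))) :
    ∃ E : FreeIdx σ ⊕ FreeIdx ρ ≃ FreeIdx π,
      (∀ i, (E (Sum.inl i)).1.castSucc = e (Sum.inl i.1.succ) - 1) ∧
      ∀ j, (E (Sum.inr j)).1.castSucc = e (Sum.inr j.1.succ) - 1 := by
  let E1 : NonMin σ ⊕ NonMin ρ ≃ {c : Fin (m' + 1) ⊕ Fin (q + 1) // ∃ k, k < e c ∧ π k (e c)} :=
    (Equiv.sumCongr (Equiv.subtypeEquivRight fun i => (nonMin_inl h hσ hn i).symm)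
      (Equiv.subtypeEquivRight fun i => (nonMin_inr h hρ hn i).symm)).trans
      (Equiv.subtypeSum (p := fun c => ∃ k, k < e c ∧ π k (e c))).symm
  let E2 : {c : Fin (m' + 1) ⊕ Fin (q + 1) // ∃ k, k < e c ∧ π k (e c)} ≃ NonMin π :=
    e.subtypeEquiv fun c => Iff.rfl
  refine ⟨((Equiv.sumCongr (freeIdxEquivNonMin σ) (freeIdxEquivNonMin ρ)).trans (E1.trans E2)).trans
    (freeIdxEquivNonMin π).symm, fun i => ?_, fun j => ?_⟩
  · exact castSucc_freeIdxEquivNonMin_symm _ _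
  · exact castSucc_freeIdxEquivNonMin_symm _ _

/-- By uniqueness it suffices to check that the two solutions, joined with base point `t_a` for the
inner one, satisfy the equations of `π`. -/
theorem solution_gap (h : IsGap e a)
    (hσ : ∀ i j, π (e (Sum.inl i)) (e (Sum.inl j)) ↔ σ i j)
    (hρ : ∀ i j, π (e (Sum.inr i)) (e (Sum.inr j)) ↔ ρ i j)
    (hn : ∀ i j, ¬ π (e (Sum.inl i)) (e (Sum.inr j)))
    (E : FreeIdx σ ⊕ FreeIdx ρ ≃ FreeIdx π)
    (hE1 : ∀ i, (E (Sum.inl i)).1.castSucc = e (Sum.inl i.1.succ) - 1)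
    (hE2 : ∀ j, (E (Sum.inr j)).1.castSucc = e (Sum.inr j.1.succ) - 1)
    (x : ℝ) (u : FreeIdx σ → ℝ) (w : FreeIdx ρ → ℝ) :
    solution π x (Sum.elim u w ∘ E.symm) =
      Sum.elim (solution σ x u) (solution ρ (solution σ x u a) w) ∘ e.symm := by
  classical
  set s := solution σ x u with hs
  set r := solution ρ (s a) w with hr
  obtain ⟨s1, s2, s3⟩ := solution_spec σ x u
  obtain ⟨r1, r2, r3⟩ := solution_spec ρ (s a) w
  rw [← hs] at s1 s2 s3
  rw [← hr] at r1 r2 r3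
  set t : Fin (m + 1) → ℝ := Sum.elim s r ∘ e.symm with ht
  have tl : ∀ i, t (e (Sum.inl i)) = s i := fun i => by simp [ht]
  have tr : ∀ i, t (e (Sum.inr i)) = r i := fun i => by simp [ht]
  -- The last coordinate of the gap has the base value `s a`, so the outer equations do not notice
  -- the gap.
  have tl1 : ∀ i, t (e (Sum.inl i) - 1) = s (i - 1) := fun i => by
    rw [h.outer_sub_one]
    split_ifs with c
    · rw [tr, r2, c]
    · rw [tl]
  have tr1 : ∀ j, t (e (Sum.inr j) - 1) = r (j - 1) := fun j => by
    rw [h.inner_sub_one]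
    split_ifs with c
    · have hl : (0 : Fin (q + 1)) - 1 = Fin.last q := by
        rw [Fin.ext_iff, Fin.coe_sub_one, if_pos rfl]; rfl
      rw [tl, c, hl, r2]
    · rw [tr]
  symm
  refine eq_solution π x _ t (fun k => ?_) ?_ fun i => ?_
  · obtain ⟨k | k, rfl⟩ := e.surjective k
    · rw [Finset.sum_filter, ← e.sum_comp, Fintype.sum_sum_type]
      simp only [tl, tr, tl1, tr1, hσ]
      have : ∀ j, ¬ π (e (Sum.inr j)) (e (Sum.inl k)) := fun j hj => hn _ _ (π.symm hj)
      simp only [this, if_false, Finset.sum_const_zero, add_zero]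
      rw [← Finset.sum_filter]
      exact s1 k
    · rw [Finset.sum_filter, ← e.sum_comp, Fintype.sum_sum_type]
      simp only [tl, tr, tl1, tr1, hρ, hn, if_false, Finset.sum_const_zero, zero_add]
      rw [← Finset.sum_filter]
      exact r1 k
  · rw [h.apply_last]
    split_ifs with c
    · rw [tr, r2, c, s2]
    · rw [tl, s2]
  · obtain ⟨i | i, rfl⟩ := E.surjective i
    · rw [hE1, tl1, ← castSucc_eq_succ_sub_one, s3]; simp
    · rw [hE2, tr1, ← castSucc_eq_succ_sub_one, r3]; simp

/-- Inserting a partition of an interval after the atom `a`. -/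
theorem LambdaMul_gap (h : IsGap e a)
    (hσ : ∀ i j, π (e (Sum.inl i)) (e (Sum.inl j)) ↔ σ i j)
    (hρ : ∀ i j, π (e (Sum.inr i)) (e (Sum.inr j)) ↔ ρ i j)
    (hn : ∀ i j, ¬ π (e (Sum.inl i)) (e (Sum.inr j))) (v : Fin (m + 1) → C01) :
    LambdaMul π v = LambdaMul σ (Function.update (fun i => v (e (Sum.inl i))) a
      (v (e (Sum.inl a)) * LambdaMul ρ fun j => v (e (Sum.inr j)))) := by
  classical
  obtain ⟨E, hE1, hE2⟩ := exists_freeIdx_equiv h hσ hρ hn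
  refine ext_zeroExt fun x _ => ?_
  rw [zeroExt_LambdaMul, zeroExt_LambdaMul, integral_sumElim E _ (integrable_fullKernel π v x)]
  refine integral_congr_ae (Filter.Eventually.of_forall fun u => ?_)
  -- For fixed outer coordinates only the second factor depends on `w`; its integral is the inner
  -- function at the point `t_a`.
  have key : ∀ w, fullKernel π v x (Sum.elim u w ∘ E.symm) =
      (∏ i, zeroExt (v (e (Sum.inl i))) (solution σ x u i)) *
        fullKernel ρ (fun j => v (e (Sum.inr j))) (solution σ x u a) w := by
    intro w
    rw [fullKernel, solution_gap h hσ hρ hn E hE1 hE2, ← e.prod_comp, Fintype.prod_sum_type]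
    simp [fullKernel]
  simp only [key]
  rw [integral_const_mul, ← zeroExt_LambdaMul, fullKernel]
  rw [← Finset.mul_prod_erase _ _ (Finset.mem_univ a),
    ← Finset.mul_prod_erase _ _ (Finset.mem_univ a), Function.update_self, zeroExt_mul,
    mul_right_comm]
  congr 1
  exact Finset.prod_congr rfl fun i hi => by rw [Function.update_of_ne (Finset.ne_of_mem_erase hi)]

end Gap

/-! ### Surgery (b): neighbors in a block -/

section Neighbors

variable {m : ℕ} {π : Setoid (Fin (m + 2))} {a : Fin (m + 1)}

/-- Skipping the atom `a`, or the atom after it. -/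
theorem succ_succAbove_related (h : π a.castSucc a.succ) (x : Fin (m + 1)) :
    π (a.succ.succAbove x) (a.castSucc.succAbove x) := by
  rcases lt_trichotomy x a with hx | rfl | hx
  · rw [Fin.succAbove_of_castSucc_lt _ _ (Fin.castSucc_lt_succ_iff.mpr hx.le),
      Fin.succAbove_of_castSucc_lt _ _ (Fin.castSucc_lt_castSucc_iff.mpr hx)]
  · rw [Fin.succAbove_castSucc_self, Fin.succAbove_succ_self]
    exact h
  · rw [Fin.succAbove_of_le_castSucc _ _ (by rwa [Fin.succ_le_castSucc_iff]),
      Fin.succAbove_of_le_castSucc _ _ (Fin.castSucc_le_castSucc_iff.mpr hx.le)]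

theorem succ_succAbove_succ (i : Fin m) : (a.succAbove i).succ = a.succ.succAbove i.succ := by
  rw [Fin.succ_succAbove_succ]

/-- Dropping the coordinate `a` drops the atom after it from the atoms that decide freeness, while
the reduced partition omits the atom `a` itself. Both deletions give the same partition because the
two atoms are related. -/
theorem nonMin_neighbors (h : π a.castSucc a.succ) (x : Fin (m + 1)) :
    (∃ k, k < a.succ.succAbove x ∧ π k (a.succ.succAbove x)) ↔
      ∃ k, k < x ∧ π.comap a.castSucc.succAbove k x := by
  have hr := succ_succAbove_related h
  have hδ : ∀ k, k < x → π (a.succ.succAbove k) (a.succ.succAbove x) →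
      ∃ k, k < x ∧ π.comap a.castSucc.succAbove k x := fun k hk hkx =>
    ⟨k, hk, π.trans (π.symm (hr k)) (π.trans hkx (hr x))⟩
  constructor
  · rintro ⟨k, hk, hkx⟩
    by_cases hka : k = a.succ
    · subst hka
      have h1 : a.castSucc < a.succ.succAbove x := Fin.castSucc_lt_succ.trans hk
      rw [← Fin.succAbove_succ_self] at h1
      refine hδ a ((Fin.strictMono_succAbove _).lt_iff_lt.mp h1) ?_
      rw [Fin.succAbove_succ_self]
      exact π.trans h hkx
    · obtain ⟨k, rfl⟩ := Fin.exists_succAbove_eq hka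
      exact hδ k ((Fin.strictMono_succAbove _).lt_iff_lt.mp hk) hkx
  · rintro ⟨k, hk, hkx⟩
    exact ⟨_, (Fin.strictMono_succAbove _).lt_iff_lt.mpr hk,
      π.trans (hr k) (π.trans hkx (π.symm (hr x)))⟩

theorem exists_freeIdx_equiv_neighbors (h : π a.castSucc a.succ) :
    ∃ E : FreeIdx (π.comap a.castSucc.succAbove) ⊕ Unit ≃ FreeIdx π,
      (∀ i, (E (Sum.inl i)).1 = a.succAbove i.1) ∧ (E (Sum.inr ())).1 = a := by
  refine ⟨Equiv.ofBijective (Sum.elim (fun i => ⟨a.succAbove i.1, ?_⟩)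
    fun _ => ⟨a, a.castSucc, Fin.castSucc_lt_succ, h⟩) ⟨?_, ?_⟩, fun i => rfl, rfl⟩
  · rw [succ_succAbove_succ, nonMin_neighbors h]
    exact i.2
  · rintro (i | i) (j | j) hij
    · exact congrArg Sum.inl (Subtype.ext (Fin.succAbove_right_injective
        (congrArg Subtype.val hij)))
    · exact absurd (congrArg Subtype.val hij) (Fin.succAbove_ne _ _)
    · exact absurd (congrArg Subtype.val hij) (Fin.succAbove_ne _ _).symm
    · rfl
  · rintro ⟨i, hi⟩
    by_cases hia : i = a
    · subst hia
      exact ⟨Sum.inr (), rfl⟩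
    · obtain ⟨i, rfl⟩ := Fin.exists_succAbove_eq hia
      rw [succ_succAbove_succ, nonMin_neighbors h] at hi
      exact ⟨Sum.inl ⟨i, hi⟩, rfl⟩

theorem val_castSucc_succAbove (k : Fin (m + 1)) : ((a.castSucc.succAbove k : Fin (m + 2)) : ℕ) =
    if (k : ℕ) < a then (k : ℕ) else k + 1 := by
  rw [Fin.succAbove]
  simp only [Fin.lt_def, Fin.val_castSucc]
  split_ifs <;> simp

theorem succAbove_sub_one (i : Fin (m + 1)) :
    a.castSucc.succAbove i - 1 = if i = a then a.castSucc else a.castSucc.succAbove (i - 1) := by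
  have hv := val_castSucc_succAbove (a := a)
  have hz : ∀ {n : ℕ} (k : Fin (n + 1)), k = 0 ↔ (k : ℕ) = 0 := fun k => Fin.ext_iff
  have ha := a.2
  have hi := i.2
  rw [Fin.ext_iff, Fin.coe_sub_one, apply_ite Fin.val, hv (i - 1)]
  simp only [Fin.coe_sub_one, Fin.ext_iff, hv, Fin.val_castSucc, Fin.val_zero]
  by_cases h0 : (i : ℕ) = 0
  · simp only [h0, if_true]
    clear hv
    grind
  · simp only [h0, if_false]
    clear hv
    grind

theorem castSucc_sub_one_eq :
    a.castSucc - 1 = a.castSucc.succAbove (a - 1) := by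
  have hv := val_castSucc_succAbove (a := a)
  have ha := a.2
  rw [Fin.ext_iff, Fin.coe_sub_one, hv]
  simp only [Fin.coe_sub_one, Fin.ext_iff, Fin.val_castSucc, Fin.val_zero]
  by_cases h0 : (a : ℕ) = 0
  · simp only [h0, if_true]
    clear hv
    grind
  · simp only [h0, if_false]
    clear hv
    grind

/-- The coordinate at `a` enters one and the same block equation with both signs, so any value `y`
may be inserted there. -/
theorem solution_neighbors (h : π a.castSucc a.succ)
    (E : FreeIdx (π.comap a.castSucc.succAbove) ⊕ Unit ≃ FreeIdx π)
    (hE1 : ∀ i, (E (Sum.inl i)).1 = a.succAbove i.1) (hE2 : (E (Sum.inr ())).1 = a)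
    (x y : ℝ) (u : FreeIdx (π.comap a.castSucc.succAbove) → ℝ) :
    solution π x (Sum.elim u (fun _ => y) ∘ E.symm) =
      Fin.insertNth (α := fun _ => ℝ) a.castSucc y
        (solution (π.comap a.castSucc.succAbove) x u) := by
  classical
  obtain ⟨s1, s2, s3⟩ := solution_spec (π.comap a.castSucc.succAbove) x u
  set s := solution (π.comap a.castSucc.succAbove) x u
  set t : Fin (m + 2) → ℝ := Fin.insertNth (α := fun _ => ℝ) a.castSucc y s with ht
  have ta : t a.castSucc = y := Fin.insertNth_apply_same _ _ _
  have ts : ∀ i, t (a.castSucc.succAbove i) = s i := fun i => Fin.insertNth_apply_succAbove _ _ _ _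
  have ts1 : ∀ i, t (a.castSucc.succAbove i - 1) = if i = a then y else s (i - 1) := fun i => by
    rw [succAbove_sub_one]
    split_ifs
    · exact ta
    · exact ts _
  have ta1 : t (a.castSucc - 1) = s (a - 1) := by rw [castSucc_sub_one_eq, ts]
  symm
  refine eq_solution π x _ t (fun k => ?_) ?_ fun i => ?_
  -- Every block contains an atom other than `a`, so it comes from a block of the reduced partition.
  · obtain ⟨k', hk'⟩ : ∃ k', π k (a.castSucc.succAbove k') := by
      by_cases hk : k = a.castSucc
      · exact ⟨a, by rw [Fin.succAbove_castSucc_self, hk]; exact h⟩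
      · obtain ⟨k', rfl⟩ := Fin.exists_succAbove_eq hk
        exact ⟨k', π.refl _⟩
    have hfil : ∀ j, π j k ↔ π j (a.castSucc.succAbove k') := fun j =>
      ⟨fun hj => π.trans hj hk', fun hj => π.trans hj (π.symm hk')⟩
    have hcom : ∀ i, π (a.castSucc.succAbove i) (a.castSucc.succAbove k') ↔
      π.comap a.castSucc.succAbove i k' := fun i => Iff.rfl
    have ha : π a.castSucc (a.castSucc.succAbove k') ↔ π.comap a.castSucc.succAbove a k' := by
      rw [← hcom, Fin.succAbove_castSucc_self]
      exact ⟨fun hj => π.trans (π.symm h) hj, fun hj => π.trans h hj⟩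
    -- The terms of the two neighbors are `y - s (a - 1)` and `s a - y`; they add up to the term of
    -- `a` in the reduced equation.
    rw [Finset.sum_filter, Fin.sum_univ_succAbove _ a.castSucc]
    simp only [hfil, ta, ta1, ts, ts1, hcom, ha]
    have := s1 k'
    rw [Finset.sum_filter, ← Finset.add_sum_erase _ _ (Finset.mem_univ a)] at this
    rw [← Finset.add_sum_erase _ _ (Finset.mem_univ a), ← add_assoc]
    refine Eq.trans ?_ this
    congr 1
    · simp only [if_true]
      split_ifs <;> ring
    · exact Finset.sum_congr rfl fun i hi => by rw [if_neg (Finset.ne_of_mem_erase hi)]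
  · rw [← s2, ← ts]
    congr 1
    rw [Fin.succAbove_of_le_castSucc _ _ (Fin.castSucc_le_castSucc_iff.mpr (Fin.le_last _)),
      Fin.succ_last]
  · obtain ⟨i | i, rfl⟩ := E.surjective i
    · have : (a.succAbove i.1).castSucc = a.castSucc.succAbove i.1.castSucc := by
        rw [Fin.castSucc_succAbove_castSucc]
      rw [hE1, this, ts, s3]; simp
    · rw [hE2, ta]; simp

/-- Neighbors in a block give rise to a factor `τ(v_a)`. -/
theorem LambdaMul_neighbors (h : π a.castSucc a.succ) (v : Fin (m + 2) → C01) :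
    LambdaMul π v = tau (v a.castSucc) •
      LambdaMul (π.comap a.castSucc.succAbove) fun i => v (a.castSucc.succAbove i) := by
  obtain ⟨E, hE1, hE2⟩ := exists_freeIdx_equiv_neighbors h
  refine ext_zeroExt fun x _ => ?_
  have hsm : ∀ (c : ℂ) (f : C01), zeroExt (c • f) x = c * zeroExt f x := fun c f =>
    (zeroExtLin x).map_smul c f
  rw [hsm, zeroExt_LambdaMul, zeroExt_LambdaMul,
    integral_sumElim_unit E _ (integrable_fullKernel π v x), tau_eq_integral_zeroExt,
    ← integral_mul_const]
  refine integral_congr_ae (Filter.Eventually.of_forall fun y => ?_)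
  simp only
  rw [← integral_const_mul]
  refine integral_congr_ae (Filter.Eventually.of_forall fun u => ?_)
  simp only
  rw [fullKernel, solution_neighbors h E hE1 hE2, Fin.prod_univ_succAbove _ a.castSucc]
  simp [fullKernel]

end Neighbors

/-! ### Surgery (c): the first and the last atom in one block -/

section FirstLast

variable {m : ℕ} {π : Setoid (Fin (m + 2))}

theorem exists_freeIdx_equiv_last (h : π 0 (Fin.last (m + 1))) :
    ∃ E : FreeIdx (π.comap Fin.castSucc) ⊕ Unit ≃ FreeIdx π,
      (∀ i, (E (Sum.inl i)).1 = i.1.castSucc) ∧ (E (Sum.inr ())).1 = Fin.last m := by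
  have key : ∀ i : Fin m, (∃ k, k < i.castSucc.succ ∧ π k i.castSucc.succ) ↔
      ∃ k, k < i.succ ∧ π.comap Fin.castSucc k i.succ := by
    intro i
    constructor
    · rintro ⟨k, hk, hki⟩
      obtain ⟨k, rfl⟩ := Fin.exists_castSucc_eq.mpr (hk.trans_le (Fin.le_last _)).ne
      exact ⟨k, hk, hki⟩
    · rintro ⟨k, hk, hki⟩
      exact ⟨k.castSucc, hk, hki⟩
  refine ⟨Equiv.ofBijective (Sum.elim (fun i => ⟨i.1.castSucc, (key _).mpr i.2⟩)
    fun _ => ⟨Fin.last m, 0, Fin.succ_pos _, h⟩) ⟨?_, ?_⟩, fun i => rfl, rfl⟩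
  · rintro (i | i) (j | j) hij
    · exact congrArg Sum.inl (Subtype.ext (Fin.castSucc_injective _ (congrArg Subtype.val hij)))
    · exact absurd (congrArg Subtype.val hij) (Fin.castSucc_lt_last _).ne
    · exact absurd (congrArg Subtype.val hij) (Fin.castSucc_lt_last _).ne'
    · rfl
  · rintro ⟨i, hi⟩
    by_cases hia : i = Fin.last m
    · subst hia
      exact ⟨Sum.inr (), rfl⟩
    · obtain ⟨i, rfl⟩ := Fin.exists_castSucc_eq.mpr hia
      exact ⟨Sum.inl ⟨i, (key i).mp hi⟩, rfl⟩

/-- The base value `x` enters with a minus sign at the first atom and a plus sign at the last, in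
the same block. It cancels, and the free coordinate `y` before the last atom takes over the role of
base point. -/
theorem solution_last (h : π 0 (Fin.last (m + 1)))
    (E : FreeIdx (π.comap Fin.castSucc) ⊕ Unit ≃ FreeIdx π)
    (hE1 : ∀ i, (E (Sum.inl i)).1 = i.1.castSucc) (hE2 : (E (Sum.inr ())).1 = Fin.last m)
    (x y : ℝ) (u : FreeIdx (π.comap Fin.castSucc) → ℝ) :
    solution π x (Sum.elim u (fun _ => y) ∘ E.symm) =
      Fin.snoc (α := fun _ => ℝ) (solution (π.comap Fin.castSucc) y u) x := by
  classical
  obtain ⟨s1, s2, s3⟩ := solution_spec (π.comap Fin.castSucc) y u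
  set s := solution (π.comap Fin.castSucc) y u
  set t : Fin (m + 2) → ℝ := Fin.snoc (α := fun _ => ℝ) s x with ht
  have tx : t (Fin.last _) = x := Fin.snoc_last _ _
  have ts : ∀ i, t (Fin.castSucc i) = s i := fun i => Fin.snoc_castSucc _ _ _
  have hz : ∀ {n : ℕ} (k : Fin (n + 1)), k = 0 ↔ (k : ℕ) = 0 := fun k => Fin.ext_iff
  have ts1 : ∀ i : Fin (m + 1), t (i.castSucc - 1) = if i = 0 then x else s (i - 1) := fun i => by
    split_ifs with hi
    · rw [← tx, hi]
      congr 1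
      rw [Fin.ext_iff, Fin.coe_sub_one]
      simp
    · rw [← ts]
      congr 1
      rw [Fin.ext_iff, Fin.coe_sub_one, Fin.val_castSucc, Fin.val_castSucc, Fin.coe_sub_one, if_neg hi, if_neg]
      · rw [hz] at hi ⊢
        exact hi
  have tx1 : t (Fin.last (m + 1) - 1) = s (Fin.last m) := by
    rw [← ts]
    congr 1
    rw [Fin.ext_iff, Fin.coe_sub_one, if_neg (Fin.last_pos).ne']
    simp
  have s0 : s ((0 : Fin (m + 1)) - 1) = s (Fin.last m) := by
    congr 1
    rw [Fin.ext_iff, Fin.coe_sub_one, if_pos rfl]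
    rfl
  symm
  refine eq_solution π x _ t (fun k => ?_) tx fun i => ?_
  · obtain ⟨k', hk'⟩ : ∃ k' : Fin (m + 1), π k k'.castSucc := by
      by_cases hk : k = Fin.last _
      · exact ⟨0, by rw [hk]; exact π.symm h⟩
      · obtain ⟨k', rfl⟩ := Fin.exists_castSucc_eq.mpr hk
        exact ⟨k', π.refl _⟩
    have hfil : ∀ j, π j k ↔ π j k'.castSucc := fun j =>
      ⟨fun hj => π.trans hj hk', fun hj => π.trans hj (π.symm hk')⟩
    have hcom : ∀ i : Fin (m + 1), π i.castSucc k'.castSucc ↔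
      π.comap Fin.castSucc i k' := fun i => Iff.rfl
    have ha : π (Fin.last _) k'.castSucc ↔ π.comap Fin.castSucc 0 k' := by
      rw [← hcom]
      exact ⟨fun hj => π.trans h hj, fun hj => π.trans (π.symm h) hj⟩
    rw [Finset.sum_filter, Fin.sum_univ_castSucc]
    simp only [hfil, tx, tx1, ts, ts1, hcom, ha]
    have := s1 k'
    rw [Finset.sum_filter, ← Finset.add_sum_erase _ _ (Finset.mem_univ 0)] at this
    rw [← Finset.add_sum_erase _ _ (Finset.mem_univ 0), add_right_comm]
    refine Eq.trans ?_ this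
    congr 1
    · rw [s0]
      simp only [if_true]
      split_ifs <;> ring
    · exact Finset.sum_congr rfl fun i hi => by rw [if_neg (Finset.ne_of_mem_erase hi)]
  · obtain ⟨i | i, rfl⟩ := E.surjective i
    · rw [hE1, ts, s3]; simp
    · rw [hE2, ts, s2]; simp

/-- If the first and the last atom lie in the same block, the last atom can be removed. -/
theorem LambdaMul_last (h : π 0 (Fin.last (m + 1))) (v : Fin (m + 2) → C01) :
    LambdaMul π v = tau (LambdaMul (π.comap Fin.castSucc) fun i => v i.castSucc) •
      v (Fin.last (m + 1)) := by
  obtain ⟨E, hE1, hE2⟩ := exists_freeIdx_equiv_last h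
  refine ext_zeroExt fun x _ => ?_
  have hsm : ∀ (c : ℂ) (f : C01), zeroExt (c • f) x = c * zeroExt f x := fun c f =>
    (zeroExtLin x).map_smul c f
  rw [hsm, zeroExt_LambdaMul,
    integral_sumElim_unit E _ (integrable_fullKernel π v x), tau_eq_integral_zeroExt,
    ← integral_mul_const]
  refine integral_congr_ae (Filter.Eventually.of_forall fun y => ?_)
  simp only
  rw [zeroExt_LambdaMul, ← integral_mul_const]
  refine integral_congr_ae (Filter.Eventually.of_forall fun u => ?_)
  simp only
  rw [fullKernel, solution_last h E hE1 hE2, Fin.prod_univ_castSucc]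
  simp [fullKernel]

end FirstLast

/-! ## Formal multilinear series as functions of words -/

section Words

variable {α R : Type*} [CommRing R]

/-- The convolution product of functions of words. -/
def conv (f g : List α → R) (l : List α) : R :=
  ∑ k ∈ Finset.range (l.length + 1), f (l.take k) * g (l.drop k)

@[simp]
theorem conv_nil (f g : List α → R) : conv f g [] = f [] * g [] := by simp [conv]

@[simp]
theorem conv_cons (f g : List α → R) (v : α) (l : List α) :
    conv f g (v :: l) = f [] * g (v :: l) + conv (fun t => f (v :: t)) g l := by
  rw [conv, List.length_cons, Finset.sum_range_succ']
  simp [conv, add_comm]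

theorem conv_append_singleton (f g : List α → R) (l : List α) (v : α) :
    conv f g (l ++ [v]) = conv f (fun t => g (t ++ [v])) l + f (l ++ [v]) * g [] := by
  induction l generalizing f with
  | nil => simp
  | cons a l ih => simp [ih, add_assoc]

theorem conv_add_left (f f' g : List α → R) (l : List α) :
    conv (fun t => f t + f' t) g l = conv f g l + conv f' g l := by
  simp [conv, add_mul, Finset.sum_add_distrib]

theorem conv_mul_left (c : R) (f g : List α → R) (l : List α) :
    conv (fun t => c * f t) g l = c * conv f g l := by
  simp [conv, mul_assoc, Finset.mul_sum]

theorem conv_assoc (f g h : List α → R) (l : List α) :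
    conv (conv f g) h l = conv f (conv g h) l := by
  induction l generalizing f g with
  | nil => simp [mul_assoc]
  | cons v l ih =>
    simp only [conv_cons, conv_nil, conv_add_left, conv_mul_left, ih]
    ring

/-- Auxiliary for `comp`: the arguments of the current block of `q` have been absorbed in `q'`, and
the values of `q` at the previous blocks have been absorbed in `f`. -/
def compAux (q : List R → R) : (List R → R) → (List R → R) → List R → R
  | f, q', [] => f [q' []]
  -- The letter `v` either joins the current block, or closes it and opens the next.
  | f, q', v :: l => compAux q f (fun t => q' (v :: t)) l +
      compAux q (fun t => f (q' [] :: t)) (fun t => q (v :: t)) l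

/-- The composition of functions of words. -/
def comp (f q : List R → R) : List R → R
  | [] => f []
  | v :: l => compAux q f (fun t => q (v :: t)) l

theorem comp_nil (f q : List R → R) : comp f q [] = f [] := rfl

theorem comp_cons (f q : List R → R) (v : R) (l : List R) :
    comp f q (v :: l) = compAux q f (fun t => q (v :: t)) l := rfl

theorem compAux_add_left (q f g q' : List R → R) (l : List R) :
    compAux q (fun t => f t + g t) q' l = compAux q f q' l + compAux q g q' l := by
  induction l generalizing f g q' with
  | nil => rfl
  | cons v l ih => simp only [compAux, ih]; ring

theorem compAux_mul_left (c : R) (q f q' : List R → R) (l : List R) :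
    compAux q (fun t => c * f t) q' l = c * compAux q f q' l := by
  induction l generalizing f q' with
  | nil => rfl
  | cons v l ih => simp only [compAux, ih]; ring

theorem comp_add_left (f g q : List R → R) (l : List R) :
    comp (fun t => f t + g t) q l = comp f q l + comp g q l := by
  cases l with
  | nil => rfl
  | cons v l => exact compAux_add_left _ _ _ _ _

theorem comp_mul_left (c : R) (f q : List R → R) (l : List R) :
    comp (fun t => c * f t) q l = c * comp f q l := by
  cases l with
  | nil => rfl
  | cons v l => exact compAux_mul_left _ _ _ _ _

/-- The product cuts the sequence of blocks in two. Either the current block belongs to the argument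
of `f`, or the cut comes before all blocks and `f` contributes only its constant term. -/
theorem compAux_conv (q f g q' : List R → R) (l : List R) :
    compAux q (conv f g) q' l =
      conv (compAux q f q') (comp g q) l + f [] * compAux q g q' l := by
  induction l generalizing f g q' with
  | nil =>
    simp only [compAux, conv_cons, conv_nil, comp_nil]
    ring
  | cons v l ih =>
    simp only [compAux, conv_cons, conv_add_left, compAux_add_left, compAux_mul_left, ih, comp_cons]
    ring

theorem comp_conv (q f g : List R → R) (l : List R) :
    comp (conv f g) q l = conv (comp f q) (comp g q) l := by
  cases l with
  | nil => simp [comp_nil]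
  | cons v l =>
    rw [comp_cons, compAux_conv, conv_cons, comp_nil, comp_cons, add_comm]
    rfl

/-- Here `k` counts the further letters taken up by the current block. The recursions for sums over
partitions have this shape. -/
theorem compAux_eq_sum (q f q' : List R → R) (l : List R) :
    compAux q f q' l = ∑ k ∈ Finset.range (l.length + 1),
      comp (fun t => f (q' (l.take k) :: t)) q (l.drop k) := by
  induction l generalizing f q' with
  | nil => simp [compAux, comp_nil]
  | cons v l ih =>
    rw [List.length_cons, Finset.sum_range_succ', compAux, ih]
    simp [comp_cons]

end Words

/-! ### The recursion agrees with the sum over compositions -/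

section Compositions

/-- Enlarging the first block of a composition. -/
def growComposition {n : ℕ} (c : Composition (n + 1)) : Composition (n + 2) where
  blocks := (c.blocks.head (by intro h; have := c.blocks_sum; simp [h] at this) + 1) ::
    c.blocks.tail
  blocks_pos := by
    intro i hi
    rcases List.mem_cons.mp hi with rfl | hi
    · omega
    · exact c.blocks_pos (List.mem_of_mem_tail hi)
  blocks_sum := by
    have hne : c.blocks ≠ [] := by intro h; have := c.blocks_sum; simp [h] at this
    have h := c.blocks_sum
    rw [← List.cons_head_tail hne] at h
    simp only [List.sum_cons] at h ⊢
    omega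

/-- Prepending a block of size `1` to a composition. -/
def consOneComposition {n : ℕ} (c : Composition (n + 1)) : Composition (n + 2) where
  blocks := 1 :: c.blocks
  blocks_pos := by
    intro i hi
    rcases List.mem_cons.mp hi with rfl | hi
    · omega
    · exact c.blocks_pos hi
  blocks_sum := by
    have h := c.blocks_sum
    simp only [List.sum_cons]
    omega

theorem exists_blocks_eq {n : ℕ} (c : Composition (n + 1)) :
    ∃ x xs, c.blocks = (x + 1) :: xs := by
  have h := c.blocks_sum
  rcases hb : c.blocks with _ | ⟨x, xs⟩
  · simp [hb] at h
  · have : 0 < x := c.blocks_pos (by rw [hb]; simp)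
    exact ⟨x - 1, xs, by rw [Nat.sub_add_cancel this]⟩

theorem growComposition_blocks {n : ℕ} (c : Composition (n + 1)) {x : ℕ} {xs : List ℕ}
    (h : c.blocks = x :: xs) : (growComposition c).blocks = (x + 1) :: xs := by
  simp [growComposition, h]

/-- The two kinds are told apart by whether the first block has size `1`; they correspond to the two
branches of `compAux`. -/
theorem bijective_composition_sum (n : ℕ) : Function.Bijective
    (Sum.elim growComposition consOneComposition :
      Composition (n + 1) ⊕ Composition (n + 1) → Composition (n + 2)) := by
  constructor
  · rintro (c | c) (d | d) h
    · obtain ⟨x, xs, hc⟩ := exists_blocks_eq c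
      obtain ⟨y, ys, hd⟩ := exists_blocks_eq d
      have := congrArg Composition.blocks h
      simp only [Sum.elim_inl, growComposition_blocks c hc, growComposition_blocks d hd] at this
      congr 1
      ext1
      rw [hc, hd]
      simpa using this
    · obtain ⟨x, xs, hc⟩ := exists_blocks_eq c
      have := congrArg Composition.blocks h
      simp [growComposition_blocks c hc, consOneComposition] at this
    · obtain ⟨x, xs, hd⟩ := exists_blocks_eq d
      have := congrArg Composition.blocks h
      simp [growComposition_blocks d hd, consOneComposition] at this
    · have := congrArg Composition.blocks h
      simp only [Sum.elim_inr, consOneComposition, List.cons.injEq, true_and] at this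
      congr 1
      ext1
      exact this
  · intro c
    obtain ⟨x, xs, hc⟩ := exists_blocks_eq c
    have hs := c.blocks_sum
    rw [hc, List.sum_cons] at hs
    have hpos : ∀ i ∈ xs, 0 < i := fun i hi => c.blocks_pos (by rw [hc]; simp [hi])
    rcases x with _ | x
    · refine ⟨Sum.inr ⟨xs, fun {i} hi => hpos i hi, by omega⟩, ?_⟩
      ext1
      rw [hc]
      rfl
    · refine ⟨Sum.inl ⟨(x + 1) :: xs, ?_, ?_⟩, ?_⟩
      · intro i hi
        rcases List.mem_cons.mp hi with rfl | hi
        · omega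
        · exact hpos i hi
      · rw [List.sum_cons]
        omega
      · ext1
        rw [hc]
        rfl

theorem sum_composition_succ {R : Type*} [AddCommMonoid R] {n : ℕ} (Φ : Composition (n + 2) → R) :
    ∑ c, Φ c = ∑ c, Φ (growComposition c) + ∑ c, Φ (consOneComposition c) := by
  rw [← (bijective_composition_sum n).sum_comp, Fintype.sum_sum_type]
  rfl

variable {R : Type*} [CommRing R]

/-- The term of a composition of functions of words, for given lengths of the blocks. -/
def blockEval (q f q' : List R → R) (l : List R) : List ℕ → R
  | [] => 0
  -- The length is `x - 1` because the first letter of the first block is already absorbed in `q'`.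
  | x :: xs => f (q' (l.take (x - 1)) :: ((l.drop (x - 1)).splitWrtCompositionAux xs).map q)

theorem compAux_eq_sum_composition (q f q' : List R → R) (l : List R) :
    compAux q f q' l = ∑ c : Composition (l.length + 1), blockEval q f q' l c.blocks := by
  induction l generalizing f q' with
  | nil =>
    have : Subsingleton (Composition 1) :=
      Fintype.card_le_one_iff_subsingleton.mp (by simp [composition_card])
    have hb : ∀ c : Composition 1, c.blocks = [1] := fun c => by
      rw [Subsingleton.elim c (Composition.ones 1)]
      rfl
    simp only [List.length_nil, hb, compAux]
    simp [blockEval, composition_card, List.splitWrtCompositionAux]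
  | cons v l ih =>
    rw [List.length_cons, sum_composition_succ, compAux, ih, ih]
    congr 1
    · refine Finset.sum_congr rfl fun c _ => ?_
      obtain ⟨x, xs, hc⟩ := exists_blocks_eq c
      rw [growComposition_blocks c hc, hc]
      simp [blockEval]
    · refine Finset.sum_congr rfl fun c _ => ?_
      obtain ⟨x, xs, hc⟩ := exists_blocks_eq c
      simp [consOneComposition, hc, blockEval, List.splitWrtCompositionAux_cons]

theorem comp_eq_sum_composition (q f : List R → R) (l : List R) :
    comp f q l = ∑ c : Composition l.length, f ((l.splitWrtComposition c).map q) := by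
  cases l with
  | nil =>
    have : Subsingleton (Composition 0) :=
      Fintype.card_le_one_iff_subsingleton.mp (by simp [composition_card])
    have hb : ∀ c : Composition 0, c.blocks = [] := fun c => by
      rw [Subsingleton.elim c (Composition.ones 0)]
      rfl
    simp [comp_nil, List.splitWrtComposition, hb, List.splitWrtCompositionAux, composition_card]
  | cons v l =>
    rw [comp_cons, compAux_eq_sum_composition, List.length_cons]
    refine Finset.sum_congr rfl fun c _ => ?_
    obtain ⟨x, xs, hc⟩ := exists_blocks_eq c
    simp [List.splitWrtComposition, hc, blockEval, List.splitWrtCompositionAux_cons]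

end Compositions

/-- A series as a function of words: the value of its term of degree `n` at a word of length `n`. -/
noncomputable def ev (p : Ser) (l : List C01) : C01 := p l.length l.get

/-! ### Dictionary between series and functions of words -/

theorem ser_apply {p : Ser} {n : ℕ} (v : Fin n → C01) : p n v = ev p (List.ofFn v) := by
  refine p.congr (by simp) fun i h1 h2 => ?_
  simp

theorem ser_apply_of_eq {p : Ser} {n : ℕ} {v : Fin n → C01} {l : List C01} (h : List.ofFn v = l) :
    p n v = ev p l := by
  rw [ser_apply, h]

theorem ev_injective {p q : Ser} (h : ∀ l, ev p l = ev q l) : p = q := by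
  funext n
  ext1 v
  rw [ser_apply, ser_apply, h]

theorem ev_add (p q : Ser) (l : List C01) : ev (p + q) l = ev p l + ev q l := rfl

theorem ev_sub (p q : Ser) (l : List C01) : ev (p - q) l = ev p l - ev q l := rfl

theorem ev_serOne_nil : ev serOne [] = 1 := rfl

theorem ev_serOne_cons (v : C01) (l : List C01) : ev serOne (v :: l) = 0 := rfl

theorem ev_serVar_nil : ev serVar [] = 0 := rfl

theorem ev_serVar_singleton (v : C01) : ev serVar [v] = v := rfl

theorem ev_serVar_cons_cons (v w : C01) (l : List C01) : ev serVar (v :: w :: l) = 0 := rfl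

theorem ev_serTau (p : Ser) (l : List C01) : ev (serTau p) l = tau (ev p l) • 1 := rfl

theorem ev_serMul (p q : Ser) : ev (serMul p q) = conv (ev p) (ev q) := by
  funext l
  rw [conv, ← Fin.sum_univ_eq_sum_range (fun k => ev p (l.take k) * ev q (l.drop k))]
  rw [ev, serMul, sum_apply]
  refine Finset.sum_congr rfl fun k _ => ?_
  change p k _ * q (l.length - k) _ = _
  have hk := k.2
  congr 1
  · refine ser_apply_of_eq (List.ext_getElem ?_ fun i h1 h2 => ?_)
    · simp; omega
    · simp
  · refine ser_apply_of_eq (List.ext_getElem ?_ fun i h1 h2 => ?_)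
    · simp
    · simp

theorem ev_comp (p q : Ser) : ev (p.comp q) = comp (ev p) (ev q) := by
  funext l
  rw [comp_eq_sum_composition, ev, FormalMultilinearSeries.comp,
    sum_apply]
  refine Finset.sum_congr rfl fun c _ => ?_
  rw [FormalMultilinearSeries.compAlongComposition_apply]
  refine ser_apply_of_eq (List.ext_getElem ?_ fun i h1 h2 => ?_)
  · simp
  · rw [List.getElem_ofFn, List.getElem_map, List.getElem_splitWrtComposition]
    refine ser_apply_of_eq (List.ext_getElem ?_ fun j h3 h4 => ?_)
    · have hi : i < c.length := by simpa using h1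
      have := c.sizeUpTo_le (i + 1)
      have h5 := c.sizeUpTo_succ hi
      simp [Composition.blocksFun] at *
      omega
    · simp

/-! ### Algebra of series and multiplicative inverses -/

theorem conv_one_left (f : List C01 → C01) (l : List C01) : conv (ev serOne) f l = f l := by
  cases l with
  | nil => simp [ev_serOne_nil]
  | cons v l =>
    have h : ∀ t, ev serOne (v :: t) = 0 := fun t => rfl
    rw [conv_cons]
    simp [ev_serOne_nil, conv, h]

theorem conv_one_right (f : List C01 → C01) (l : List C01) : conv f (ev serOne) l = f l := by
  induction l generalizing f with
  | nil => simp [ev_serOne_nil]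
  | cons v l ih => simp [ev_serOne_cons, ih]

theorem serMul_assoc (p q r : Ser) : serMul (serMul p q) r = serMul p (serMul q r) := by
  refine ev_injective fun l => ?_
  simp only [ev_serMul]
  exact conv_assoc _ _ _ _

theorem serOne_serMul (p : Ser) : serMul serOne p = p :=
  ev_injective fun l => by rw [ev_serMul, conv_one_left]

theorem serMul_serOne (p : Ser) : serMul p serOne = p :=
  ev_injective fun l => by rw [ev_serMul, conv_one_right]

theorem serMul_comp (p q r : Ser) : (serMul p q).comp r = serMul (p.comp r) (q.comp r) := by
  refine ev_injective fun l => ?_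
  simp only [ev_serMul, ev_comp]
  exact comp_conv _ _ _ _

/-- The right inverse of a series with constant term `1`. -/
noncomputable def serRightInv (p : Ser) : Ser
  | 0 => serOne 0
  | n + 1 => -∑ k : Fin (n + 1), concatMul (k := k + 1) (l := n - k) (by omega) (p (k + 1))
      (serRightInv p (n - k))

theorem ev_serRightInv_nil (p : Ser) : ev (serRightInv p) [] = 1 := by
  change serRightInv p 0 _ = 1
  rw [serRightInv]
  rfl

theorem ev_serRightInv_cons (p : Ser) (v : C01) (l : List C01) :
    ev (serRightInv p) (v :: l) = -conv (fun t => ev p (v :: t)) (ev (serRightInv p)) l := by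
  rw [conv, ← Fin.sum_univ_eq_sum_range
    (fun k => ev p (v :: l.take k) * ev (serRightInv p) (l.drop k)), ev]
  change (serRightInv p (l.length + 1)) _ = _
  rw [serRightInv, neg_apply, sum_apply]
  refine congrArg Neg.neg (Finset.sum_congr rfl fun k _ => ?_)
  change p (k + 1) _ * serRightInv p (l.length - k) _ = _
  have hk := k.2
  congr 1
  · refine ser_apply_of_eq (List.ext_getElem ?_ fun i h1 h2 => ?_)
    · simp; omega
    · cases i <;> simp
  · refine ser_apply_of_eq (List.ext_getElem ?_ fun i h1 h2 => ?_)
    · simp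
    · simp [add_right_comm]

theorem serMul_serRightInv {p : Ser} (hp : ev p [] = 1) : serMul p (serRightInv p) = serOne := by
  refine ev_injective fun l => ?_
  rw [ev_serMul]
  cases l with
  | nil => rw [conv_nil, hp, one_mul, ev_serRightInv_nil, ev_serOne_nil]
  | cons v l => rw [conv_cons, hp, one_mul, ev_serRightInv_cons, neg_add_cancel, ev_serOne_cons]

/-- The right inverse again has constant term `1`, hence has a right inverse itself; by
associativity that one is `p`. -/
theorem isMulInverse_serRightInv {p : Ser} (hp : ev p [] = 1) :
    IsMulInverse p (serRightInv p) := by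
  have h1 := serMul_serRightInv hp
  have h2 := serMul_serRightInv (ev_serRightInv_nil p)
  have h3 : p = serRightInv (serRightInv p) := by
    calc p = serMul p (serMul (serRightInv p) (serRightInv (serRightInv p))) := by
          rw [h2, serMul_serOne]
      _ = _ := by rw [← serMul_assoc, h1, serOne_serMul]
  rw [← h3] at h2
  exact ⟨h1, h2⟩

theorem IsMulInverse.unique {p r s : Ser} (hr : IsMulInverse p r) (hs : IsMulInverse p s) :
    r = s := by
  rw [← serMul_serOne r, ← hs.1, ← serMul_assoc, hr.2, serOne_serMul]

theorem existsUnique_isMulInverse {p : Ser} (hp : ev p [] = 1) : ∃! r, IsMulInverse p r :=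
  ⟨_, isMulInverse_serRightInv hp, fun _ h => h.unique (isMulInverse_serRightInv hp)⟩

/-! ## Sums over classes of partitions -/

/-- `Λ_π(v_1, …, v_{n-1}) v_n`, with the value `1` for `n = 0`. -/
noncomputable def lambdaWord : {n : ℕ} → Setoid (Fin n) → (Fin n → C01) → C01
  | 0, _, _ => 1
  | _ + 1, π, v => LambdaMul π v

open Classical in
/-- The sum of `Λ_π(v_1, …, v_{n-1}) v_n` over the partitions `π` in a class, for a word `v`. -/
noncomputable def classSum (P : ∀ n, Setoid (Fin n) → Prop) (l : List C01) : C01 :=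
  ∑ π : Setoid (Fin l.length) with P _ π, lambdaWord π l.get

open Classical in
theorem classSum_eq (P : ∀ n, Setoid (Fin n) → Prop) {l : List C01} {n : ℕ} {v : Fin n → C01}
    (h : List.ofFn v = l) :
    classSum P l = ∑ π : Setoid (Fin n) with P _ π, lambdaWord π v := by
  obtain rfl : l.length = n := by rw [← h, List.length_ofFn]
  obtain rfl : v = l.get := by
    apply List.ofFn_injective
    rw [h, List.ofFn_get]
  rfl

theorem classSum_congr {P Q : ∀ n, Setoid (Fin n) → Prop} {l : List C01}
    (h : ∀ π : Setoid (Fin l.length), P _ π ↔ Q _ π) : classSum P l = classSum Q l := by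
  classical
  unfold classSum
  exact Finset.sum_congr (Finset.filter_congr fun π _ => h π) fun _ _ => rfl

instance : Unique (Setoid (Fin 0)) where
  default := ⊥
  uniq π := by
    ext i
    exact i.elim0

theorem classSum_nil {P : ∀ n, Setoid (Fin n) → Prop} (h : ∀ π, P 0 π) : classSum P [] = 1 := by
  classical
  rw [classSum_eq P (l := []) (n := 0) (v := Fin.elim0) rfl, Finset.filter_true_of_mem fun π _ => h π]
  rw [Fintype.sum_unique]
  rfl

/-- The interval `[s, e)` of `Fin n`. -/
def interval (n s e : ℕ) : Set (Fin n) := {i | s ≤ (i : ℕ) ∧ (i : ℕ) < e}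

theorem mem_interval {n s e : ℕ} {i : Fin n} : i ∈ interval n s e ↔ s ≤ (i : ℕ) ∧ (i : ℕ) < e :=
  Iff.rfl

/-- No interval that begins at an atom of index `1, …, a` splits `π`. -/
def NoGap (a n : ℕ) (π : Setoid (Fin n)) : Prop :=
  ∀ s e, 0 < s → s ≤ a → s < e → e ≤ n → ¬ Splits (interval n s e) π

theorem noGap_zero {n : ℕ} (π : Setoid (Fin n)) : NoGap 0 n π :=
  fun s e h1 h2 => absurd h1 (by omega)

theorem Splits.compl {n : ℕ} {S : Set (Fin n)} {π : Setoid (Fin n)} (h : Splits S π) :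
    Splits Sᶜ π := fun i j hij hi hj => hi (h j i (π.symm hij) hj)

/-- A proper interval that starts at the first atom may be traded for its complement, which is an
interval with a later start. -/
theorem isConn_iff {n : ℕ} (π : Setoid (Fin n)) : IsConn π ↔
    ∀ s e, 0 < s → s < e → e ≤ n → ¬ Splits (interval n s e) π := by
  constructor
  · intro h s e hs hse he hS
    refine h s (e - s) (by omega) (by omega) (by omega) ?_
    convert hS using 1
    ext i
    simp only [interval, Set.mem_ofPred_eq]
    omega
  · intro h p q hq hpq hqn hS
    rcases Nat.eq_zero_or_pos p with rfl | hp
    · refine h q n hq hqn le_rfl ?_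
      convert hS.compl using 1
      ext i
      have := i.2
      simp only [interval, Set.mem_ofPred_eq, Set.mem_compl_iff]
      omega
    · exact h p (p + q) hp (by omega) hpq hS

theorem noGap_iff_isConn {a n : ℕ} (π : Setoid (Fin n)) (h : n ≤ a + 1) :
    NoGap a n π ↔ IsConn π := by
  rw [isConn_iff]
  exact ⟨fun hg s e hs hse he => hg s e hs (by omega) hse he,
    fun hg s e hs _ hse he => hg s e hs hse he⟩

/-! ### Gluing partitions -/

/-- The partition of a union given by partitions of the parts. -/
def glue {α β γ : Type*} (e : α ⊕ β ≃ γ) (σ : Setoid α) (ρ : Setoid β) : Setoid γ where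
  r x y := Sum.LiftRel σ ρ (e.symm x) (e.symm y)
  iseqv :=
    { refl := fun x => by
        rcases e.symm x with i | i
        · exact Sum.LiftRel.inl (σ.refl i)
        · exact Sum.LiftRel.inr (ρ.refl i)
      symm := fun {x y} h => by
        generalize e.symm x = x at *
        generalize e.symm y = y at *
        rcases h with h | h
        · exact Sum.LiftRel.inl (σ.symm h)
        · exact Sum.LiftRel.inr (ρ.symm h)
      trans := fun {x y z} h h' => by
        generalize e.symm x = x at *
        generalize e.symm y = y at *
        generalize e.symm z = z at *
        rcases h with h | h <;> rcases h' with h' | h'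
        · exact Sum.LiftRel.inl (σ.trans h h')
        · exact Sum.LiftRel.inr (ρ.trans h h') }

section Glue

variable {α β γ : Type*} (e : α ⊕ β ≃ γ) (σ : Setoid α) (ρ : Setoid β)

theorem glue_inl_inl (i j : α) : glue e σ ρ (e (Sum.inl i)) (e (Sum.inl j)) ↔ σ i j := by
  change Sum.LiftRel σ ρ _ _ ↔ _
  simp

theorem glue_inr_inr (i j : β) : glue e σ ρ (e (Sum.inr i)) (e (Sum.inr j)) ↔ ρ i j := by
  change Sum.LiftRel σ ρ _ _ ↔ _
  simp

theorem not_glue_inl_inr (i : α) (j : β) : ¬ glue e σ ρ (e (Sum.inl i)) (e (Sum.inr j)) := by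
  change ¬ Sum.LiftRel σ ρ _ _
  simp

theorem comap_inl_glue : (glue e σ ρ).comap (fun i => e (Sum.inl i)) = σ := by
  ext i j
  exact glue_inl_inl e σ ρ i j

theorem comap_inr_glue : (glue e σ ρ).comap (fun i => e (Sum.inr i)) = ρ := by
  ext i j
  exact glue_inr_inr e σ ρ i j

theorem glue_comap (π : Setoid γ) (hn : ∀ i j, ¬ π (e (Sum.inl i)) (e (Sum.inr j))) :
    glue e (π.comap fun i => e (Sum.inl i)) (π.comap fun j => e (Sum.inr j)) = π := by
  ext x y
  obtain ⟨x | x, rfl⟩ := e.surjective x <;> obtain ⟨y | y, rfl⟩ := e.surjective y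
  · exact glue_inl_inl e _ _ x y
  · exact iff_of_false (not_glue_inl_inr e _ _ x y) (hn x y)
  · exact iff_of_false (fun h => not_glue_inl_inr e _ _ y x (Setoid.symm' _ h))
      (fun h => hn y x (Setoid.symm' _ h))
  · exact glue_inr_inr e _ _ x y

end Glue

theorem exists_isGap {m m' q : ℕ} (hm : m = m' + q + 1) (a : Fin (m' + 1)) :
    ∃ e : Fin (m' + 1) ⊕ Fin (q + 1) ≃ Fin (m + 1), IsGap e a := by
  have ha := a.2
  let f : Fin (m' + 1) ⊕ Fin (q + 1) → Fin (m + 1) := Sum.elim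
    (fun i => ⟨if (i : ℕ) ≤ a then (i : ℕ) else i + (q + 1), by have := i.2; split_ifs <;> omega⟩)
    (fun j => ⟨a + 1 + j, by have := j.2; omega⟩)
  have hf : Function.Injective f := by
    rintro (i | i) (j | j) h
    · have h := congrArg Fin.val h
      simp only [f, Sum.elim_inl] at h
      congr 1
      ext
      split_ifs at h <;> omega
    · have h := congrArg Fin.val h
      have := j.2
      simp only [f, Sum.elim_inl, Sum.elim_inr] at h
      split_ifs at h <;> omega
    · have h := congrArg Fin.val h
      have := i.2
      simp only [f, Sum.elim_inl, Sum.elim_inr] at h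
      split_ifs at h <;> omega
    · have h := congrArg Fin.val h
      simp only [f, Sum.elim_inr] at h
      congr 1
      ext
      omega
  have hb : Function.Bijective f := (Fintype.bijective_iff_injective_and_card f).mpr
    ⟨hf, by simp; omega⟩
  exact ⟨Equiv.ofBijective f hb, fun i => rfl, fun j => rfl⟩

/-! ### Splitting off the longest interval after an atom -/

section Gap

variable {m m' q : ℕ} {e : Fin (m' + 1) ⊕ Fin (q + 1) ≃ Fin (m + 1)} {a : Fin (m' + 1)}

theorem IsGap.inl_notMem (h : IsGap e a) (i : Fin (m' + 1)) :
    e (Sum.inl i) ∉ interval (m + 1) (a + 1) (a + 1 + (q + 1)) := by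
  rw [mem_interval, h.outer]
  split_ifs <;> omega

theorem IsGap.inr_mem (h : IsGap e a) (j : Fin (q + 1)) :
    e (Sum.inr j) ∈ interval (m + 1) (a + 1) (a + 1 + (q + 1)) := by
  have := j.2
  rw [mem_interval, h.inner]
  omega

theorem IsGap.splits_iff (h : IsGap e a) (π : Setoid (Fin (m + 1))) :
    Splits (interval (m + 1) (a + 1) (a + 1 + (q + 1))) π ↔
      ∀ i j, ¬ π (e (Sum.inl i)) (e (Sum.inr j)) := by
  constructor
  · intro hS i j hij
    exact h.inl_notMem i (hS _ _ (π.symm hij) (h.inr_mem j))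
  · intro hn x y hxy hx
    obtain ⟨x | x, rfl⟩ := e.surjective x
    · exact absurd hx (h.inl_notMem x)
    · obtain ⟨y | y, rfl⟩ := e.surjective y
      · exact absurd (π.symm hxy) (hn _ _)
      · exact h.inr_mem y

theorem splits_of_splits_comap {π : Setoid (Fin (m + 1))}
    (hn : ∀ i j, ¬ π (e (Sum.inl i)) (e (Sum.inr j))) {T : Set (Fin (m + 1))}
    {S : Set (Fin (m' + 1))} (hS : Splits S (π.comap fun i => e (Sum.inl i)))
    (hT : ∀ i, e (Sum.inl i) ∈ T ↔ i ∈ S) (hT' : ∀ i j, e (Sum.inr i) ∈ T → e (Sum.inr j) ∈ T) :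
    Splits T π := by
  intro x y hxy hx
  obtain ⟨x | x, rfl⟩ := e.surjective x <;> obtain ⟨y | y, rfl⟩ := e.surjective y
  · exact (hT y).mpr (hS x y hxy ((hT x).mp hx))
  · exact absurd hxy (hn _ _)
  · exact absurd (π.symm hxy) (hn _ _)
  · exact hT' x y hx

/-- Splitting intervals of the outer partition and of `π` correspond by adding or removing the gap.
An outer interval that starts right after `a` becomes, with the gap added, a longer splitting
interval after `a`, so maximality of the gap excludes it. -/
theorem noGap_comap_iff (h : IsGap e a) {π : Setoid (Fin (m + 1))}
    (hn : ∀ i j, ¬ π (e (Sum.inl i)) (e (Sum.inr j))) :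
    NoGap (a + 1) (m' + 1) (π.comap fun i => e (Sum.inl i)) ↔
      NoGap a (m + 1) π ∧ ∀ k, q + 1 < k → a + 1 + k ≤ m + 1 →
        ¬ Splits (interval (m + 1) (a + 1) (a + 1 + k)) π := by
  have hm := IsGap.card_eq e
  have ha := a.2
  constructor
  · intro hg
    constructor
    · intro s f hs hsa hsf hf hS
      -- The trace of `[s, f)` on the outer atoms; it is nonempty because `s ≤ a` is not in the gap.
      have hS' : Splits (interval (m' + 1) s
          (if f ≤ a + 1 then f else if f ≤ a + 1 + (q + 1) then a + 1 else f - (q + 1)))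
          (π.comap fun i => e (Sum.inl i)) := by
        intro i j hij hi
        have := hS _ _ hij (by
          rw [mem_interval] at hi ⊢
          rw [h.outer]
          split_ifs at hi ⊢ <;> omega)
        rw [mem_interval] at this ⊢
        rw [h.outer] at this
        split_ifs at this ⊢ <;> omega
      refine hg _ _ hs (by omega) ?_ ?_ hS' <;> split_ifs <;> omega
    · intro k hk hkm hS
      have hS' : Splits (interval (m' + 1) (a + 1) (a + 1 + (k - (q + 1))))
          (π.comap fun i => e (Sum.inl i)) := by
        intro i j hij hi
        have := hS _ _ hij (by
          rw [mem_interval] at hi ⊢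
          rw [h.outer]
          split_ifs <;> omega)
        rw [mem_interval] at this ⊢
        rw [h.outer] at this
        split_ifs at this <;> omega
      exact hg _ _ (by omega) le_rfl (by omega) (by omega) hS'
  · rintro ⟨hg, hk⟩ s f hs hsa hsf hf hS
    by_cases hfa : f ≤ a + 1
    · refine hg s f hs (by omega) hsf (by omega) (splits_of_splits_comap hn hS (fun i => ?_) ?_)
      · rw [mem_interval, mem_interval, h.outer]
        split_ifs <;> omega
      · intro i j hi
        rw [mem_interval, h.inner] at hi
        omega
    -- An outer interval that reaches beyond `a` is completed by the gap.
    · have hS' : Splits (interval (m + 1) s (f + (q + 1))) π := by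
        refine splits_of_splits_comap hn hS (fun i => ?_) ?_
        · rw [mem_interval, mem_interval, h.outer]
          split_ifs <;> omega
        · intro i j hi
          have := j.2
          rw [mem_interval, h.inner] at hi ⊢
          omega
      by_cases hs' : s ≤ a
      · exact hg s _ hs hs' (by omega) (by omega) hS'
      · obtain rfl : s = a + 1 := by omega
        refine hk (f + (q + 1) - (a + 1)) (by omega) (by omega) ?_
        convert hS' using 2
        omega

-- A partition split by the gap is a pair `(σ, ρ)`. The condition `P` restricts only `σ`, so `ρ`
-- runs over all partitions, and multilinearity in the entry `a` collects them into one factor.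
open Classical in
theorem sum_gap (h : IsGap e a) (P : Setoid (Fin (m' + 1)) → Prop) (v : Fin (m + 1) → C01) :
    ∑ π : Setoid (Fin (m + 1)) with (∀ i j, ¬ π (e (Sum.inl i)) (e (Sum.inr j))) ∧
        P (π.comap fun i => e (Sum.inl i)), LambdaMul π v =
      ∑ σ : Setoid (Fin (m' + 1)) with P σ, LambdaMul σ (Function.update
        (fun i => v (e (Sum.inl i))) a
        (v (e (Sum.inl a)) * ∑ ρ, LambdaMul ρ fun j => v (e (Sum.inr j)))) := by
  have hlin : ∀ σ : Setoid (Fin (m' + 1)), LambdaMul σ (Function.update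
        (fun i => v (e (Sum.inl i))) a
        (v (e (Sum.inl a)) * ∑ ρ, LambdaMul ρ fun j => v (e (Sum.inr j)))) =
      ∑ ρ, LambdaMul (glue e σ ρ) v := by
    intro σ
    rw [Finset.mul_sum]
    refine ((LambdaMul σ).toMultilinearMap.map_update_sum _ _ _ _).trans ?_
    exact Finset.sum_congr rfl fun ρ _ => (LambdaMul_gap h (glue_inl_inl e σ ρ)
      (glue_inr_inr e σ ρ) (not_glue_inl_inr e σ ρ) v).symm
  simp only [hlin]
  rw [← Finset.sum_product']
  refine Finset.sum_nbij'
    (fun π => (π.comap (fun i => e (Sum.inl i)), π.comap fun j => e (Sum.inr j)))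
    (fun x => glue e x.1 x.2) ?_ ?_ ?_ ?_ ?_
  · intro π hπ
    simpa using (Finset.mem_filter.mp hπ).2.2
  · intro x hx
    simp only [Finset.mem_product, Finset.mem_filter, Finset.mem_univ, true_and, and_true] at hx
    simp only [Finset.mem_filter, Finset.mem_univ, true_and, comap_inl_glue]
    exact ⟨not_glue_inl_inr e _ _, hx⟩
  · intro π hπ
    exact glue_comap e π (Finset.mem_filter.mp hπ).2.1
  · intro x _
    simp [comap_inl_glue, comap_inr_glue]
  · intro π hπ
    simp only [glue_comap e π (Finset.mem_filter.mp hπ).2.1]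

end Gap

open Classical in
/-- The length of the longest interval after the atom `a` that splits `π`. -/
noncomputable def gapLength {n : ℕ} (a N : ℕ) (π : Setoid (Fin n)) : ℕ :=
  Nat.findGreatest (fun k => Splits (interval n (a + 1) (a + 1 + k)) π) N

theorem noGap_and_gapLength_eq_zero {a n N : ℕ} (hn : n = a + 1 + N) (π : Setoid (Fin n)) :
    NoGap a n π ∧ gapLength a N π = 0 ↔ NoGap (a + 1) n π := by
  classical
  rw [gapLength, Nat.findGreatest_eq_zero_iff]
  constructor
  · rintro ⟨hg, hk⟩ s e hs hsa hse he hS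
    by_cases h : s ≤ a
    · exact hg s e hs h hse he hS
    · obtain rfl : s = a + 1 := by omega
      refine @hk (e - (a + 1)) (by omega) (by omega) ?_
      convert hS using 2
      omega
  · intro hg
    exact ⟨fun s e hs hsa => hg s e hs (by omega),
      fun k hk hkN => hg _ _ (by omega) le_rfl (by omega) (by omega)⟩

/-- Maximality of the interval is exactly the condition on longer intervals in `noGap_comap_iff`. -/
theorem noGap_and_gapLength_eq_succ {m m' q N : ℕ}
    {e : Fin (m' + 1) ⊕ Fin (q + 1) ≃ Fin (m + 1)} {a : Fin (m' + 1)} (h : IsGap e a)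
    (hN : m = a + N) (π : Setoid (Fin (m + 1))) :
    NoGap a (m + 1) π ∧ gapLength a N π = q + 1 ↔
      (∀ i j, ¬ π (e (Sum.inl i)) (e (Sum.inr j))) ∧
        NoGap (a + 1) (m' + 1) (π.comap fun i => e (Sum.inl i)) := by
  classical
  have hm := IsGap.card_eq e
  have ha := a.2
  rw [gapLength, Nat.findGreatest_eq_iff]
  constructor
  · rintro ⟨hg, h1, h2, h3⟩
    have hn := (h.splits_iff π).mp (h2 (by omega))
    exact ⟨hn, (noGap_comap_iff h hn).mpr ⟨hg, fun k hk hkm => h3 hk (by omega)⟩⟩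
  · rintro ⟨hn, hg⟩
    obtain ⟨hg1, hg2⟩ := (noGap_comap_iff h hn).mp hg
    exact ⟨hg1, by omega, fun _ => (h.splits_iff π).mpr hn, fun k hk hkN => hg2 k hk (by omega)⟩

/-- Partitions are sorted by the length `k` of the longest splitting interval after the letter `v`.
Surgery (a) absorbs the letters of that interval into `v`, and afterwards no interval after `v`
splits. -/
theorem classSum_noGap (w : List C01) (v : C01) (l : List C01) :
    classSum (NoGap w.length) (w ++ v :: l) = ∑ k ∈ Finset.range (l.length + 1),
      classSum (NoGap (w.length + 1))
        (w ++ (v * classSum (fun _ _ => True) (l.take k)) :: l.drop k) := by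
  classical
  set a := w.length with ha
  set N := l.length with hN
  let V : Fin (a + N + 1) → C01 := fun i => (w ++ v :: l)[(i : ℕ)]'(by
    have := i.2
    simp [← ha, ← hN]
    omega)
  have hV : List.ofFn V = w ++ v :: l := by
    refine List.ext_getElem (by simp [← ha, ← hN]; omega) fun i h1 h2 => ?_
    rw [List.getElem_ofFn]
  rw [classSum_eq _ hV]
  rw [← Finset.sum_fiberwise_of_maps_to (t := Finset.range (N + 1)) (g := gapLength a N)
    (fun π _ => Finset.mem_range.mpr (Nat.lt_succ_of_le (Nat.findGreatest_le N)))]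
  refine Finset.sum_congr rfl fun k hk => ?_
  have hkN : k ≤ N := Nat.lt_succ_iff.mp (Finset.mem_range.mp hk)
  rw [Finset.filter_filter]
  rcases k with _ | q
  -- For `k = 0` the empty word contributes the factor `1`.
  · rw [List.take_zero, List.drop_zero, classSum_nil fun _ => trivial, mul_one, classSum_eq _ hV]
    refine Finset.sum_congr (Finset.filter_congr fun π _ => ?_) fun _ _ => rfl
    exact noGap_and_gapLength_eq_zero (by omega) π
  · obtain ⟨m', hm'⟩ : ∃ m', a + N = m' + q + 1 := ⟨a + N - (q + 1), by omega⟩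
    let b : Fin (m' + 1) := ⟨a, by omega⟩
    obtain ⟨e, he⟩ := exists_isGap hm' b
    have hfil : ∀ π : Setoid (Fin (a + N + 1)),
        (NoGap a (a + N + 1) π ∧ gapLength a N π = q + 1) ↔ _ :=
      fun π => noGap_and_gapLength_eq_succ he rfl π
    rw [Finset.sum_congr (Finset.filter_congr fun π _ => hfil π) fun _ _ => rfl]
    refine (sum_gap he (NoGap (a + 1) (m' + 1)) V).trans ?_
    have hinner : classSum (fun _ _ => True) (l.take (q + 1)) =
        ∑ ρ, LambdaMul ρ fun j => V (e (Sum.inr j)) := by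
      rw [classSum_eq (n := q + 1) (v := fun j => V (e (Sum.inr j)))]
      · rw [Finset.filter_true]
        rfl
      · refine List.ext_getElem (by simp; omega) fun i h1 h2 => ?_
        simp only [List.getElem_ofFn, V, he.inner]
        rw [List.getElem_append_right (by simp [b]; omega)]
        simp only [List.getElem_take]
        have : a + 1 + i - w.length = i + 1 := by omega
        simp [b, this]
    rw [classSum_eq (n := m' + 1) (v := Function.update (fun i => V (e (Sum.inl i))) b
        (V (e (Sum.inl b)) * ∑ ρ, LambdaMul ρ fun j => V (e (Sum.inr j))))]
    · rfl
    · rw [← hinner]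
      have hb : V (e (Sum.inl b)) = v := by
        simp [V, he.outer, b, ha]
      rw [hb]
      refine List.ext_getElem (by simp; omega) fun i h1 h2 => ?_
      rw [List.getElem_ofFn, Function.update_apply]
      rcases lt_trichotomy i a with hi | hi | hi
      · rw [if_neg (by simp [b, Fin.ext_iff]; omega)]
        simp only [V, he.outer, b, hi.le, if_true]
        rw [List.getElem_append_left (by omega)]
        rw [List.getElem_append_left (by omega)]
      · subst hi
        rw [if_pos (by simp [b])]
        simp [ha]
      · rw [if_neg (by simp [b, Fin.ext_iff]; omega)]
        have hia : ¬ i ≤ a := by omega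
        simp only [V, he.outer, b, hia, if_false]
        rw [List.getElem_append_right (by omega)]
        rw [List.getElem_append_right (by omega)]
        rw [List.getElem_cons, List.getElem_cons, dif_neg (by omega), dif_neg (by omega),
          List.getElem_drop]
        congr 1
        omega

/-- No block contains neighbors among the first `a + 1` atoms. -/
def NoNeighborsUpTo (a n : ℕ) (π : Setoid (Fin n)) : Prop :=
  ∀ i j : Fin n, (i : ℕ) + 1 = j → (i : ℕ) < a → ¬ π i j

/-- The connected partitions without neighbors in a block among the first `a + 1` atoms. -/
def ConnNoNeighborsUpTo (a n : ℕ) (π : Setoid (Fin n)) : Prop :=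
  IsConn π ∧ NoNeighborsUpTo a n π

theorem noNeighborsUpTo_iff {a n : ℕ} (h : n ≤ a + 1) (π : Setoid (Fin n)) :
    NoNeighborsUpTo a n π ↔ NoNeighbors π :=
  ⟨fun hg i j hij => hg i j hij (by have := j.2; omega), fun hg i j hij _ => hg i j hij⟩

/-- Reindexing a sum over partitions along `ι`, if every atom is related to one in its range. -/
theorem sum_comap {α β R : Type*} [Fintype (Setoid α)] [Fintype (Setoid β)] [AddCommMonoid R]
    {ι : α → β} {c : β → α} (hc : ∀ i, c (ι i) = i)
    (S : Setoid β → Prop) (T : Setoid α → Prop) [DecidablePred S] [DecidablePred T]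
    (hS : ∀ π, S π → ∀ x, π (ι (c x)) x)
    (hST : ∀ π : Setoid β, (∀ x, π (ι (c x)) x) → (S π ↔ T (π.comap ι))) (f : Setoid α → R) :
    ∑ π with S π, f (π.comap ι) = ∑ σ with T σ, f σ := by
  have hid : ∀ σ : Setoid α, (σ.comap c).comap ι = σ := fun σ => by
    ext i j
    change σ (c (ι i)) (c (ι j)) ↔ _
    rw [hc, hc]
  refine Finset.sum_nbij' (fun π => π.comap ι) (fun σ => σ.comap c) ?_ ?_ ?_ ?_ ?_
  · intro π hπ
    have h := (Finset.mem_filter.mp hπ).2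
    exact Finset.mem_filter.mpr ⟨Finset.mem_univ _, (hST π (hS π h)).mp h⟩
  · intro σ hσ
    have h := (Finset.mem_filter.mp hσ).2
    refine Finset.mem_filter.mpr ⟨Finset.mem_univ _, (hST _ fun x => ?_).mpr ?_⟩
    · change σ (c (ι (c x))) (c x)
      rw [hc]
    · rwa [hid]
  · intro π hπ
    have h := hS π (Finset.mem_filter.mp hπ).2
    ext x y
    change π (ι (c x)) (ι (c y)) ↔ π x y
    exact ⟨fun hxy => π.trans (π.symm (h x)) (π.trans hxy (h y)),
      fun hxy => π.trans (h x) (π.trans hxy (π.symm (h y)))⟩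
  · intro σ _
    exact hid σ
  · intro π _
    rfl

theorem Splits.comap {n m : ℕ} {S : Set (Fin n)} {π : Setoid (Fin n)} (h : Splits S π)
    (ι : Fin m → Fin n) : Splits (ι ⁻¹' S) (π.comap ι) :=
  fun i j hij hi => h (ι i) (ι j) hij hi

/-! ### Merging neighbors within the class of connected partitions -/

section Neighbors

variable {m : ℕ} {a : Fin (m + 1)}

theorem predAbove_succAbove (i : Fin (m + 1)) : a.predAbove (a.castSucc.succAbove i) = i :=
  Fin.predAbove_succAbove a i

theorem succAbove_predAbove_related {π : Setoid (Fin (m + 2))} (h : π a.castSucc a.succ)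
    (x : Fin (m + 2)) : π (a.castSucc.succAbove (a.predAbove x)) x := by
  by_cases hx : x = a.castSucc
  · rw [hx, Fin.predAbove_castSucc_self, Fin.succAbove_castSucc_self]
    exact π.symm h
  · rw [Fin.succAbove_predAbove hx]

/-- A splitting set contains both neighbors or neither, so splitting intervals survive the merging
of the two atoms and its reversal. -/
theorem isConn_comap_neighbors {π : Setoid (Fin (m + 2))} (h : π a.castSucc a.succ) :
    IsConn π ↔ IsConn (π.comap a.castSucc.succAbove) := by
  have ha := a.2
  rw [isConn_iff, isConn_iff]
  constructor
  · intro hg s e hs hse he hS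
    -- These are the ends of the preimage of `[s, e)` under the map that merges the two neighbors.
    refine hg (if s ≤ a then s else s + 1) (if e ≤ a then e else e + 1)
      (by split_ifs <;> omega) (by split_ifs <;> omega) (by split_ifs <;> omega) ?_
    have key : ∀ x : Fin (m + 2), x ∈ interval (m + 2) (if s ≤ a then s else s + 1)
        (if e ≤ a then e else e + 1) ↔ a.predAbove x ∈ interval (m + 1) s e := by
      intro x
      rw [mem_interval, mem_interval]
      by_cases hx : x = a.castSucc
      · rw [hx, Fin.predAbove_castSucc_self, Fin.val_castSucc]
        split_ifs <;> omega
      · obtain ⟨x, rfl⟩ := Fin.exists_succAbove_eq hx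
        rw [predAbove_succAbove, val_castSucc_succAbove]
        split_ifs <;> omega
    intro x y hxy hx
    rw [key] at hx ⊢
    exact hS _ _ (π.trans (succAbove_predAbove_related h x)
      (π.trans hxy (π.symm (succAbove_predAbove_related h y)))) hx
  · intro hg s e hs hse he hS
    -- This rules out the interval consisting of `a` alone, whose trace would be empty.
    have hmem : a.castSucc ∈ interval (m + 2) s e ↔ a.succ ∈ interval (m + 2) s e :=
      ⟨hS _ _ h, hS _ _ (π.symm h)⟩
    rw [mem_interval, mem_interval, Fin.val_castSucc, Fin.val_succ] at hmem
    refine hg (if s ≤ a then s else s - 1) (if e ≤ a then e else e - 1)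
      (by split_ifs <;> omega) (by split_ifs <;> omega) (by split_ifs <;> omega) ?_
    convert hS.comap a.castSucc.succAbove using 1
    ext x
    rw [Set.mem_preimage, mem_interval, mem_interval, val_castSucc_succAbove]
    split_ifs <;> omega

/-- Up to the relation `π`, omitting `a` is the same as omitting the atom after it, and the latter
leaves the first `a + 1` atoms in place. -/
theorem noNeighborsUpTo_comap {π : Setoid (Fin (m + 2))} (h : π a.castSucc a.succ) :
    NoNeighborsUpTo a (m + 2) π ↔
      NoNeighborsUpTo a (m + 1) (π.comap a.castSucc.succAbove) := by
  have ha := a.2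
  have hr := succ_succAbove_related h
  have hv : ∀ k : Fin (m + 1), ((a.succ.succAbove k : Fin (m + 2)) : ℕ) =
      if (k : ℕ) ≤ a then (k : ℕ) else k + 1 := fun k => by
    rw [Fin.succAbove]
    simp only [Fin.lt_def, Fin.val_castSucc, Fin.val_succ, Nat.lt_succ_iff]
    split_ifs <;> simp
  constructor
  · intro hg i j hij hia hπ
    refine hg (a.succ.succAbove i) (a.succ.succAbove j) ?_ ?_
      (π.trans (hr i) (π.trans hπ (π.symm (hr j))))
    · rw [hv, hv]
      split_ifs <;> omega
    · rw [hv]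
      split_ifs <;> omega
  · intro hg i j hij hia hπ
    have hi : a.succ.succAbove ⟨i, by omega⟩ = i := by
      ext
      rw [hv, if_pos hia.le]
    have hj : a.succ.succAbove ⟨j, by omega⟩ = j := by
      ext
      rw [hv, if_pos (show (j : ℕ) ≤ a by omega)]
    refine hg ⟨i, by omega⟩ ⟨j, by omega⟩ hij hia ?_
    have h1 := hr ⟨i, by omega⟩
    have h2 := hr ⟨j, by omega⟩
    rw [hi] at h1
    rw [hj] at h2
    exact π.trans (π.symm h1) (π.trans hπ h2)

open Classical in
theorem sum_neighbors (v : Fin (m + 2) → C01) :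
    ∑ π : Setoid (Fin (m + 2)) with ConnNoNeighborsUpTo a (m + 2) π ∧ π a.castSucc a.succ,
        LambdaMul π v =
      tau (v a.castSucc) • ∑ σ : Setoid (Fin (m + 1)) with ConnNoNeighborsUpTo a (m + 1) σ,
        LambdaMul σ fun i => v (a.castSucc.succAbove i) := by
  rw [Finset.smul_sum, ← sum_comap (ι := a.castSucc.succAbove) (c := a.predAbove)
    predAbove_succAbove (fun π => ConnNoNeighborsUpTo a (m + 2) π ∧ π a.castSucc a.succ)
    (fun σ => ConnNoNeighborsUpTo a (m + 1) σ)
    (fun π hπ x => succAbove_predAbove_related hπ.2 x) (fun π hπ => ?_)]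
  · refine Finset.sum_congr rfl fun π hπ => ?_
    exact LambdaMul_neighbors (Finset.mem_filter.mp hπ).2.2 v
  · have h : π a.castSucc a.succ := by
      have := hπ a.castSucc
      rw [Fin.predAbove_castSucc_self, Fin.succAbove_castSucc_self] at this
      exact π.symm this
    rw [ConnNoNeighborsUpTo, ConnNoNeighborsUpTo, isConn_comap_neighbors h,
      noNeighborsUpTo_comap h]
    exact and_iff_left h

end Neighbors

/-- Either the atoms of `v` and `u` are unrelated, which extends the condition by one atom, or
surgery (b) removes `v` at the cost of the factor `τ(v)`. -/
theorem classSum_connNoNeighborsUpTo (w : List C01) (v u : C01) (l : List C01) :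
    classSum (ConnNoNeighborsUpTo w.length) (w ++ v :: u :: l) =
      classSum (ConnNoNeighborsUpTo (w.length + 1)) (w ++ v :: u :: l) +
        tau v • classSum (ConnNoNeighborsUpTo w.length) (w ++ u :: l) := by
  classical
  set a := w.length with ha
  set N := l.length with hN
  let V : Fin (a + N + 2) → C01 := fun i => (w ++ v :: u :: l)[(i : ℕ)]'(by
    have := i.2
    simp [← ha, ← hN]
    omega)
  have hV : List.ofFn V = w ++ v :: u :: l := by
    refine List.ext_getElem (by simp [← ha, ← hN]; omega) fun i h1 h2 => ?_
    rw [List.getElem_ofFn]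
  let b : Fin (a + N + 1) := ⟨a, by omega⟩
  have hV' : List.ofFn (fun i => V (b.castSucc.succAbove i)) = w ++ u :: l := by
    refine List.ext_getElem (by simp [← ha, ← hN]; omega) fun i h1 h2 => ?_
    rw [List.getElem_ofFn]
    by_cases hi : i < a
    · simp only [V, val_castSucc_succAbove, b, hi, if_true]
      rw [List.getElem_append_left (by omega), List.getElem_append_left (by omega)]
    · simp only [V, val_castSucc_succAbove, b, hi, if_false]
      rw [List.getElem_append_right (by omega), List.getElem_append_right (by omega)]
      have : i + 1 - w.length = i - w.length + 1 := by omega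
      simp [this]
  rw [classSum_eq _ hV, classSum_eq _ hV, classSum_eq _ hV']
  have hb : V b.castSucc = v := by simp [V, b, ha]
  have := sum_neighbors (a := b) V
  rw [hb] at this
  rw [← Finset.sum_filter_not_add_sum_filter _
    fun π : Setoid (Fin (a + N + 2)) => π b.castSucc b.succ, Finset.filter_filter,
    Finset.filter_filter]
  refine congrArg₂ (· + ·) ?_ this
  refine Finset.sum_congr (Finset.filter_congr fun π _ => ?_) fun _ _ => rfl
  rw [ConnNoNeighborsUpTo, ConnNoNeighborsUpTo, and_assoc]
  refine and_congr_right fun _ => ⟨fun h i j hij hi => ?_, fun h => ⟨fun i j hij hi =>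
    h i j hij (by omega), h _ _ rfl (Nat.lt_succ_self _)⟩⟩
  by_cases hia : (i : ℕ) < a
  · exact h.1 i j hij hia
  · obtain rfl : i = b.castSucc := by
      ext
      simp only [b, Fin.val_castSucc]
      omega
    obtain rfl : j = b.succ := by
      ext
      rw [← hij]
      rfl
    exact h.2

theorem smul_eq_algebraMap_mul (c : ℂ) (f : C01) : c • f = algebraMap ℂ C01 c * f := by
  ext
  simp

/-! ### Removing the last atom when it is related to the first -/

section FirstLast

variable {m : ℕ}

/-- The retraction of `Fin (m + 2)` onto `Fin (m + 1)` that maps the last atom to the first. -/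
def lastToZero (x : Fin (m + 2)) : Fin (m + 1) :=
  Fin.snoc (α := fun _ => Fin (m + 1)) id 0 x

theorem lastToZero_castSucc (i : Fin (m + 1)) : lastToZero i.castSucc = i := by
  simp [lastToZero]

theorem lastToZero_last : lastToZero (Fin.last (m + 1)) = 0 := by
  simp [lastToZero]

theorem castSucc_lastToZero_related {π : Setoid (Fin (m + 2))} (h : π 0 (Fin.last (m + 1)))
    (x : Fin (m + 2)) : π (lastToZero x).castSucc x := by
  by_cases hx : x = Fin.last _
  · rw [hx, lastToZero_last]
    exact h
  · obtain ⟨x, rfl⟩ := Fin.exists_castSucc_eq.mpr hx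
    rw [lastToZero_castSucc]

/-- The intervals in `isConn_iff` avoid the first atom, so those that split `π` avoid the last one
as well. -/
theorem isConn_comap_last {π : Setoid (Fin (m + 2))} (h : π 0 (Fin.last (m + 1))) :
    IsConn π ↔ IsConn (π.comap Fin.castSucc) := by
  rw [isConn_iff, isConn_iff]
  constructor
  · intro hg s e hs hse he hS
    refine hg s e hs hse (by omega) ?_
    have key : ∀ x : Fin (m + 2), x ∈ interval (m + 2) s e ↔
        lastToZero x ∈ interval (m + 1) s e := by
      intro x
      rw [mem_interval, mem_interval]
      by_cases hx : x = Fin.last _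
      · rw [hx, lastToZero_last, Fin.val_last, Fin.val_zero]
        omega
      · obtain ⟨x, rfl⟩ := Fin.exists_castSucc_eq.mpr hx
        rw [lastToZero_castSucc, Fin.val_castSucc]
    intro x y hxy hx
    rw [key] at hx ⊢
    exact hS _ _ (π.trans (castSucc_lastToZero_related h x)
      (π.trans hxy (π.symm (castSucc_lastToZero_related h y)))) hx
  · intro hg s e hs hse he hS
    have hmem : Fin.last (m + 1) ∉ interval (m + 2) s e := fun hl => by
      have := hS _ _ (π.symm h) hl
      rw [mem_interval, Fin.val_zero] at this
      omega
    rw [mem_interval, Fin.val_last] at hmem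
    exact hg s e hs hse (by omega) (hS.comap Fin.castSucc)

/-- The last atom is related to its neighbor exactly if the first one is. This is the extra
condition that distinguishes `PC` from `PC⁺`. -/
theorem noNeighbors_comap_last {π : Setoid (Fin (m + 2))} (h : π 0 (Fin.last (m + 1))) :
    NoNeighbors π ↔
      NoNeighbors (π.comap Fin.castSucc) ∧ ¬ π.comap Fin.castSucc 0 (Fin.last m) := by
  constructor
  · intro hg
    exact ⟨fun i j hij => hg i.castSucc j.castSucc hij, fun h0 =>
      hg (Fin.last m).castSucc (Fin.last (m + 1)) rfl (π.trans (π.symm h0) h)⟩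
  · rintro ⟨h1, h2⟩ i j hij hπ
    obtain ⟨i, rfl⟩ : ∃ i' : Fin (m + 1), i'.castSucc = i := ⟨⟨i, by omega⟩, rfl⟩
    by_cases hj : j = Fin.last _
    · subst hj
      obtain rfl : i = Fin.last m := by
        ext
        simpa using hij
      exact h2 (π.trans h (π.symm hπ))
    · obtain ⟨j, rfl⟩ := Fin.exists_castSucc_eq.mpr hj
      exact h1 i j hij hπ

open Classical in
theorem sum_first_last (v : Fin (m + 2) → C01) :
    ∑ π : Setoid (Fin (m + 2)) with IsPCPlus π ∧ π 0 (Fin.last (m + 1)), LambdaMul π v =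
      tau (∑ σ : Setoid (Fin (m + 1)) with IsPC σ, LambdaMul σ fun i => v i.castSucc) •
        v (Fin.last (m + 1)) := by
  rw [map_sum, smul_eq_algebraMap_mul, map_sum, Finset.sum_mul]
  rw [← sum_comap (ι := Fin.castSucc) (c := lastToZero)
    lastToZero_castSucc (fun π => IsPCPlus π ∧ π 0 (Fin.last (m + 1))) (fun σ => IsPC σ)
    (fun π hπ x => castSucc_lastToZero_related hπ.2 x) (fun π hπ => ?_)]
  · refine Finset.sum_congr rfl fun π hπ => ?_
    exact (LambdaMul_last (Finset.mem_filter.mp hπ).2.2 v).trans (smul_eq_algebraMap_mul _ _)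
  · have h : π 0 (Fin.last (m + 1)) := by
      have := hπ (Fin.last _)
      rwa [lastToZero_last] at this
    rw [IsPCPlus, IsPC, isConn_comap_last h, noNeighbors_comap_last h]
    exact and_iff_left h

end FirstLast

/-! ## The series -/

theorem ev_serD (l : List C01) : ev serD l = classSum (fun _ _ => True) l := by
  classical
  cases l with
  | nil => rw [classSum_nil fun _ => trivial]; rfl
  | cons v l =>
    rw [classSum, Finset.filter_true, ev]
    exact sum_apply _ _ _

theorem ev_serOne_add_serC (l : List C01) : ev (serOne + serC) l = classSum (fun _ => IsConn) l := by
  classical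
  cases l with
  | nil =>
    rw [classSum_nil fun π => fun p q h1 h2 => by omega, ev_add, ev_serOne_nil]
    exact add_zero _
  | cons v l =>
    rw [ev_add, ev_serOne_cons, zero_add, classSum, ev]
    exact sum_apply _ _ _

theorem ev_serC_cons (v : C01) (l : List C01) :
    ev serC (v :: l) = classSum (fun _ => IsConn) (v :: l) := by
  rw [← ev_serOne_add_serC, ev_add, ev_serOne_cons, zero_add]

theorem ev_serB {l : List C01} (hl : l ≠ []) : ev serB l = classSum (fun _ => IsPCPlus) l := by
  classical
  cases l with
  | nil => exact absurd rfl hl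
  | cons v l => exact sum_apply _ _ _

theorem ev_serB_nil : ev serB [] = 0 := rfl

theorem ev_serA_nil : ev serA [] = 0 := rfl

theorem ev_serA_singleton (v : C01) : ev serA [v] = 0 := by
  classical
  refine (sum_apply _ _ _).trans (Finset.sum_eq_zero fun π hπ => ?_)
  exact absurd (π.refl 0) (Finset.mem_filter.mp hπ).2.2.2

theorem ev_serB_singleton (v : C01) : ev serB [v] = v := by
  classical
  rw [ev_serB (by simp), classSum_eq _ (l := [v]) (n := 1) (v := fun _ => v) rfl]
  have hall : ∀ π : Setoid (Fin 1), IsPCPlus π := fun π =>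
    ⟨fun p q h1 h2 h3 => by omega, fun i j hij => by omega⟩
  rw [Finset.filter_true_of_mem fun π _ => hall π, Finset.sum_eq_single ⊤]
  · exact LambdaMul_one _ _
  · intro π _ hπ
    refine absurd ?_ hπ
    ext i j
    rw [Subsingleton.elim i j]
    exact iff_of_true (π.refl j) (Setoid.refl' ⊤ j)
  · simp

theorem ev_serB_concat (l : List C01) (v : C01) (hl : l ≠ []) :
    ev serB (l ++ [v]) = tau (ev serA l) • v + ev serA (l ++ [v]) := by
  classical
  obtain ⟨m, hm⟩ : ∃ m, l.length = m + 1 :=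
    Nat.exists_eq_succ_of_ne_zero (by simpa using hl)
  let V : Fin (m + 2) → C01 := Fin.snoc (α := fun _ => C01) (fun i => l[(i : ℕ)]) v
  have hV1 : List.ofFn (fun i : Fin (m + 1) => V i.castSucc) = l := by
    refine List.ext_getElem (by simp [hm]) fun i h1 h2 => ?_
    rw [List.getElem_ofFn]
    exact Fin.snoc_castSucc _ _ _
  have hV : List.ofFn V = l ++ [v] := by
    rw [List.ofFn_succ', hV1]
    simp [V]
  rw [ev_serB (by simp), classSum_eq _ hV, ← ser_apply_of_eq (p := serA) hV1,
    ← ser_apply_of_eq (p := serA) hV,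
    ← Finset.sum_filter_add_sum_filter_not _
      fun π : Setoid (Fin (m + 2)) => π 0 (Fin.last (m + 1)), Finset.filter_filter,
    Finset.filter_filter]
  refine congrArg₂ (· + ·) ?_ ?_
  · refine (sum_first_last V).trans ?_
    rw [show V (Fin.last (m + 1)) = v by simp [V]]
    congr 2
    exact (sum_apply _ _ _).symm
  · refine Eq.trans ?_ (sum_apply _ _ _).symm
    refine Finset.sum_congr (Finset.filter_congr fun π _ => ?_) fun _ _ => rfl
    rw [IsPCPlus, IsPC, and_assoc]

theorem serB_eq : serB = serVar + serMul (serTau serA) serVar + serA := by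
  refine ev_injective fun l => ?_
  rw [ev_add, ev_add, ev_serMul]
  rcases List.eq_nil_or_concat l with rfl | ⟨l, v, rfl⟩
  · simp [ev_serB_nil, ev_serVar_nil, ev_serA_nil]
  · rw [List.concat_eq_append, conv_append_singleton, ev_serVar_nil, mul_zero, add_zero]
    have hvar : (fun t => ev serVar (t ++ [v])) = fun t => ev serOne t * v := by
      funext t
      rcases t with _ | ⟨u, _ | ⟨w, t⟩⟩ <;> simp [ev_serOne_nil, ev_serOne_cons,
        ev_serVar_singleton, ev_serVar_cons_cons]
    have hconv : conv (ev (serTau serA)) (fun t => ev serVar (t ++ [v])) l =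
        tau (ev serA l) • v := by
      rw [hvar]
      have : conv (ev (serTau serA)) (fun t => ev serOne t * v) l =
          conv (ev (serTau serA)) (ev serOne) l * v := by
        simp [conv, Finset.sum_mul, mul_assoc]
      rw [this, conv_one_right, ev_serTau, smul_mul_assoc, one_mul]
    rw [hconv]
    rcases eq_or_ne l [] with rfl | hl
    · simp only [List.nil_append, ev_serA_nil, ev_serA_singleton, ev_serB_singleton,
        ev_serVar_singleton, map_zero, add_zero]
      rw [smul_eq_algebraMap_mul, map_zero, zero_mul, add_zero]
    · rw [ev_serB_concat l v hl]
      obtain ⟨u, t, rfl⟩ := List.exists_cons_of_ne_nil hl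
      rcases t with _ | ⟨w, t⟩ <;> simp [ev_serVar_cons_cons]

/-! ### The equation between C and B -/

theorem ev_smul_word (p : Ser) (w : List C01) (c : ℂ) (x : C01) (l : List C01) :
    ev p (w ++ (c • x) :: l) = c • ev p (w ++ x :: l) := by
  let V : Fin (w.length + l.length + 1) → C01 := fun i => (w ++ x :: l)[(i : ℕ)]'(by
    have := i.2
    simp
    omega)
  let b : Fin (w.length + l.length + 1) := ⟨w.length, by omega⟩
  have key : ∀ y, List.ofFn (Function.update V b y) = w ++ y :: l := fun y => by
    refine List.ext_getElem (by simp; omega) fun i h1 h2 => ?_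
    rw [List.getElem_ofFn, Function.update_apply]
    split_ifs with hi
    · have : i = w.length := congrArg Fin.val hi
      subst this
      simp
    · have : i ≠ w.length := fun h => hi (Fin.ext h)
      simp only [V]
      rcases lt_or_gt_of_ne this with h | h
      · rw [List.getElem_append_left h, List.getElem_append_left h]
      · rw [List.getElem_append_right h.le, List.getElem_append_right h.le,
          List.getElem_cons, List.getElem_cons, dif_neg (by omega), dif_neg (by omega)]
  rw [← ser_apply_of_eq (key (c • x)), ← ser_apply_of_eq (key x),
    ContinuousMultilinearMap.map_update_smul]

theorem ev_serVar_concat_mul (r : Ser) (l : List C01) (v : C01) :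
    ev (serMul r serVar) (l ++ [v]) = ev r l * v := by
  rw [ev_serMul, conv_append_singleton, ev_serVar_nil, mul_zero, add_zero]
  have hvar : (fun t => ev serVar (t ++ [v])) = fun t => ev serOne t * v := by
    funext t
    rcases t with _ | ⟨u, _ | ⟨w, t⟩⟩ <;> simp [ev_serOne_nil, ev_serOne_cons,
      ev_serVar_singleton, ev_serVar_cons_cons]
  rw [hvar]
  have : conv (ev r) (fun t => ev serOne t * v) l = conv (ev r) (ev serOne) l * v := by
    simp [conv, Finset.sum_mul, mul_assoc]
  rw [this, conv_one_right]

theorem ev_serOne_sub_serTau_nil : ev (serOne - serTau serVar) [] = 1 := by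
  rw [ev_sub, ev_serOne_nil, ev_serTau, ev_serVar_nil, map_zero, smul_eq_algebraMap_mul, map_zero]
  ring

theorem ev_serOne_sub_serTau_cons (v : C01) (l : List C01) :
    ev (serOne - serTau serVar) (v :: l) = -algebraMap ℂ C01 (tau v) * ev serOne l := by
  rw [ev_sub, ev_serOne_cons, ev_serTau, smul_eq_algebraMap_mul]
  rcases l with _ | ⟨w, l⟩
  · rw [ev_serVar_singleton, ev_serOne_nil]
    ring
  · rw [ev_serVar_cons_cons, ev_serOne_cons, map_zero, map_zero]
    ring

/-- Comparison of coefficients in `(1 - τ(g)) r = 1`. Iterated, it gives the terms `τ(g_1) ⋯ τ(g_n)`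
of the geometric series. -/
theorem ev_inverse_cons {r : Ser} (hr : IsMulInverse (serOne - serTau serVar) r)
    (v : C01) (l : List C01) : ev r (v :: l) = tau v • ev r l := by
  have h := congrArg (fun p => ev p (v :: l)) hr.1
  simp only [ev_serMul, conv_cons, ev_serOne_sub_serTau_nil, one_mul, ev_serOne_sub_serTau_cons,
    ev_serOne_cons, conv_mul_left, conv_one_left] at h
  rw [smul_eq_algebraMap_mul]
  linear_combination h

theorem ev_inverse_nil {r : Ser} (hr : IsMulInverse (serOne - serTau serVar) r) :
    ev r [] = 1 := by
  have h := congrArg (fun p => ev p []) hr.1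
  simpa only [ev_serMul, conv_nil, ev_serOne_sub_serTau_nil, one_mul, ev_serOne_nil] using h

/-- The prefix `w` holds the finished blocks of the composition, each already reduced to one letter.
The empty word is excluded since `B` has constant term `0`, whereas the class sum is `1` there. -/
theorem classSum_eq_comp_serB {q : List C01 → C01} (h1 : ∀ v, q [v] = v)
    (h2 : ∀ v u l, q (v :: u :: l) = tau v • q (u :: l)) (w l : List C01) (hwl : w ++ l ≠ []) :
    classSum (ConnNoNeighborsUpTo w.length) (w ++ l) = comp (fun t => ev serB (w ++ t)) q l := by
  have hB : ∀ (w : List C01) (n : ℕ), w ≠ [] → w.length ≤ n + 1 →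
      classSum (ConnNoNeighborsUpTo n) w = ev serB w := fun w n hw hn => by
    rw [ev_serB hw]
    refine classSum_congr fun π => ?_
    rw [ConnNoNeighborsUpTo, noNeighborsUpTo_iff hn, IsPCPlus]
  induction l generalizing w with
  | nil =>
    rw [List.append_nil] at hwl ⊢
    rw [comp_nil, List.append_nil, hB w _ hwl (by omega)]
  | cons v l ih =>
    rcases l with _ | ⟨u, l⟩
    · rw [comp_cons, compAux, h1, hB _ _ hwl (by simp)]
    · have e1 := ih w (by simp)
      have e2 := ih (w ++ [v]) (by simp)
      rw [List.length_append, List.length_singleton] at e2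
      simp only [List.append_assoc, List.singleton_append] at e2
      -- Unrelated neighbors correspond to closing the block `[v]`, related ones to a block that
      -- continues with `u`; in the second case `h2` supplies the factor `τ(v)`.
      rw [classSum_connNoNeighborsUpTo, e1, e2, comp_cons _ _ v, compAux, h1, add_comm]
      refine congrArg₂ (· + ·) ?_ rfl
      rw [comp_cons, compAux_eq_sum, compAux_eq_sum, Finset.smul_sum]
      refine Finset.sum_congr rfl fun k _ => ?_
      have : (fun t => ev serB (w ++ q (v :: u :: l.take k) :: t)) =
          fun t => (tau v • (1 : C01)) * ev serB (w ++ q (u :: l.take k) :: t) := by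
        funext t
        rw [h2, ev_smul_word, smul_mul_assoc, one_mul]
      rw [this, comp_mul_left, smul_mul_assoc, one_mul]

theorem serC_eq_serB_comp {r : Ser} (hr : IsMulInverse (serOne - serTau serVar) r) :
    serC = serB.comp (serMul r serVar) := by
  have hrl : ∀ l v, ev (serMul r serVar) (l ++ [v]) = ev r l * v := ev_serVar_concat_mul r
  refine ev_injective fun l => ?_
  rw [ev_comp]
  rcases l with _ | ⟨v, l⟩
  · rfl
  · rw [ev_serC_cons]
    refine Eq.trans ?_ (classSum_eq_comp_serB (q := ev (serMul r serVar)) (fun u => ?_)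
      (fun u w t => ?_) [] (v :: l) (by simp))
    · refine classSum_congr fun π => ?_
      exact ⟨fun h => ⟨h, fun i j _ hi => absurd hi (Nat.not_lt_zero _)⟩, fun h => h.1⟩
    · have := hrl [] u
      rw [ev_inverse_nil hr, one_mul] at this
      exact this
    · rcases List.eq_nil_or_concat (w :: t) with h | ⟨s, x, h⟩
      · cases h
      · rw [h, List.concat_eq_append, hrl, ← List.cons_append, hrl, ev_inverse_cons hr,
          smul_mul_assoc]

/-! ### The equation between D and C -/

theorem ev_serMul_serVar_nil (p : Ser) : ev (serMul serVar p) [] = 0 := by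
  rw [ev_serMul, conv_nil, ev_serVar_nil, zero_mul]

theorem ev_serMul_serVar_cons (p : Ser) (v : C01) (l : List C01) :
    ev (serMul serVar p) (v :: l) = v * ev p l := by
  have : (fun t => ev serVar (v :: t)) = fun t => v * ev serOne t := by
    funext t
    rcases t with _ | ⟨w, t⟩ <;> simp [ev_serVar_singleton, ev_serVar_cons_cons, ev_serOne_nil,
      ev_serOne_cons]
  rw [ev_serMul, conv_cons, ev_serVar_nil, zero_mul, zero_add, this, conv_mul_left, conv_one_left]

/-- Each block of the composition is a letter with the longest splitting interval after it,
contributing `v D(…)`. The prefix `w` holds the blocks already contracted; once no letters remain,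
`NoGap` means connected. -/
theorem classSum_noGap_eq_comp (w l : List C01) :
    classSum (NoGap w.length) (w ++ l) =
      comp (fun t => classSum (fun _ => IsConn) (w ++ t)) (ev (serMul serVar serD)) l := by
  induction hn : l.length using Nat.strong_induction_on generalizing w l with
  | _ n ih =>
    rcases l with _ | ⟨v, l⟩
    · rw [comp_nil, List.append_nil]
      exact classSum_congr fun π => noGap_iff_isConn π (by omega)
    · rw [classSum_noGap, comp_cons, compAux_eq_sum]
      refine Finset.sum_congr rfl fun k _ => ?_
      rw [ev_serMul_serVar_cons, ev_serD]
      have := ih (l.drop k).length (by simp at hn ⊢; omega)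
        (w ++ [v * classSum (fun _ _ => True) (l.take k)]) (l.drop k) rfl
      rw [List.length_append, List.length_singleton] at this
      simpa only [List.append_assoc, List.singleton_append] using this

theorem serD_eq_comp : serD = (serOne + serC).comp (serMul serVar serD) := by
  refine ev_injective fun l => ?_
  rw [ev_comp, ev_serD, funext ev_serOne_add_serC]
  exact (classSum_congr fun π => iff_of_true trivial (noGap_zero π)).trans
    (classSum_noGap_eq_comp [] l)

theorem serOne_comp (p : Ser) : serOne.comp p = serOne := by
  refine ev_injective fun l => ?_
  rw [ev_comp]
  cases l with
  | nil => rfl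
  | cons v l =>
    rw [comp_cons, compAux_eq_sum, ev_serOne_cons]
    refine Finset.sum_eq_zero fun k _ => ?_
    have : (fun t => ev serOne (ev p (v :: l.take k) :: t)) =
        fun t => 0 * ev serOne t := by
      funext t
      rw [ev_serOne_cons, zero_mul]
    rw [this, comp_mul_left, zero_mul]

theorem add_comp (p q r : Ser) : (p + q).comp r = p.comp r + q.comp r := by
  refine ev_injective fun l => ?_
  rw [ev_comp, ev_add, ev_comp, ev_comp]
  exact comp_add_left _ _ _ l

theorem serD_eq : serD = serOne + serC.comp (serMul serVar serD) := by
  nth_rewrite 1 [serD_eq_comp]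
  rw [add_comp, serOne_comp]

/-! ### Compositional inverses -/

theorem serVar_comp {p : Ser} (hp : ev p [] = 0) : serVar.comp p = p := by
  have := p.id_comp Fin.elim0
  have h0 : p 0 Fin.elim0 = 0 := (ser_apply _).trans hp
  rwa [h0] at this

theorem comp_serVar (p : Ser) : p.comp serVar = p := p.comp_id 0

/-- A series with zero constant term and the identity in degree one has a two-sided inverse. -/
theorem exists_isCompInverse {p : Ser} (h0 : ev p [] = 0) (h1 : ∀ v, ev p [v] = v) :
    ∃ q, ev q [] = 0 ∧ IsCompInverse p q := by
  have hp1 : p 1 = (continuousMultilinearCurryFin1 ℂ C01 C01).symm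
      (ContinuousLinearEquiv.refl ℂ C01) := by
    ext1 v
    rw [ser_apply_of_eq (l := [v 0]) (by simp), h1]
    rfl
  have hp0 : p 0 0 = 0 := (ser_apply _).trans h0
  refine ⟨p.leftInv (ContinuousLinearEquiv.refl ℂ C01) 0, ?_, ?_, ?_⟩
  · rw [ev]
    change (p.leftInv _ _) 0 _ = 0
    rw [FormalMultilinearSeries.leftInv_coeff_zero]
    rfl
  · rw [FormalMultilinearSeries.leftInv_eq_rightInv p _ 0 hp1]
    exact (FormalMultilinearSeries.comp_rightInv p _ 0 hp1).trans
      (congrArg (FormalMultilinearSeries.id ℂ C01) hp0)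
  · exact FormalMultilinearSeries.leftInv_comp p _ 0 hp1

/-- Only the left inverse property of `h r(h)` is computed. Since `F` has some two-sided inverse `G`
without constant term, associativity identifies every left inverse with `G`. -/
theorem isCompInverse_iff {r : Ser} (hr : IsMulInverse (serOne + serC) r) (H : Ser) :
    IsCompInverse (serMul serVar serD) H ↔ H = serMul serVar r := by
  set F := serMul serVar serD with hF
  have hF0 : ev F [] = 0 := ev_serMul_serVar_nil _
  have hF1 : ∀ v, ev F [v] = v := fun v => by
    rw [hF, ev_serMul_serVar_cons, ev_serD, classSum_nil fun _ => trivial, mul_one]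
  -- Substituting `F` into `(1 + C) r = 1` turns the first factor into `D`.
  have hinv : serMul serD (r.comp F) = serOne := by
    nth_rewrite 1 [serD_eq_comp]
    rw [← hF, ← serMul_comp, hr.1, serOne_comp]
  have hleft : (serMul serVar r).comp F = serVar := by
    rw [serMul_comp, serVar_comp hF0, hF, serMul_assoc, ← hF, hinv, serMul_serOne]
  obtain ⟨G, hG0, hG1, hG2⟩ := exists_isCompInverse hF0 hF1
  have hG : serMul serVar r = G := by
    calc serMul serVar r = (serMul serVar r).comp (F.comp G) := by rw [hG1, comp_serVar]
      _ = G := by rw [← FormalMultilinearSeries.comp_assoc, hleft, serVar_comp hG0]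
  rw [hG]
  constructor
  · rintro ⟨h1, h2⟩
    calc H = H.comp (F.comp G) := by rw [hG1, comp_serVar]
      _ = G := by rw [← FormalMultilinearSeries.comp_assoc, h2, serVar_comp hG0]
  · rintro rfl
    exact ⟨hG1, hG2⟩

end Vandermonde

theorem mainTheorem6 :
    -- `B(g) = g + τ(A(g)) g + A(g)`
    (Vandermonde.serB = Vandermonde.serVar
        + Vandermonde.serMul (Vandermonde.serTau Vandermonde.serA) Vandermonde.serVar
        + Vandermonde.serA) ∧
    -- `1 - τ(g)` is invertible and `C(g) = B((1 - τ(g))⁻¹ g)`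
    ((∃! r, Vandermonde.IsMulInverse
        (Vandermonde.serOne - Vandermonde.serTau Vandermonde.serVar) r) ∧
      ∀ r, Vandermonde.IsMulInverse
          (Vandermonde.serOne - Vandermonde.serTau Vandermonde.serVar) r →
        Vandermonde.serC = Vandermonde.serB.comp (Vandermonde.serMul r Vandermonde.serVar)) ∧
    -- `D(g) = 1 + C(g D(g))`
    (Vandermonde.serD = Vandermonde.serOne
        + Vandermonde.serC.comp (Vandermonde.serMul Vandermonde.serVar Vandermonde.serD)) ∧
    -- `1 + C(h)` is invertible, and `F(g) = g D(g)` has the compositional inverse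
    -- `h (1 + C(h))⁻¹` and no other
    ((∃! r, Vandermonde.IsMulInverse (Vandermonde.serOne + Vandermonde.serC) r) ∧
      ∀ r, Vandermonde.IsMulInverse (Vandermonde.serOne + Vandermonde.serC) r →
        ∀ H, Vandermonde.IsCompInverse
            (Vandermonde.serMul Vandermonde.serVar Vandermonde.serD) H ↔
          H = Vandermonde.serMul Vandermonde.serVar r) := by
  open Vandermonde in
  have h1 : ev (serOne + serC) [] = 1 := (ev_serOne_add_serC []).trans
    (classSum_nil fun π => fun p q h1 h2 => by omega)
  exact ⟨serB_eq, ⟨existsUnique_isMulInverse ev_serOne_sub_serTau_nil, fun r hr => serC_eq_serB_comp hr⟩, serD_eq,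
    existsUnique_isMulInverse h1, fun r hr H => isCompInverse_iff hr H⟩
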